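/- Let $n,k\ge 1$ be integers and $s\in(0,1)$. For $u\in L^2(\mathbb R^d)$ put $$\mathcal E^s_d(u)=\int_{\mathbb R^d}|\xi|^{2s}|\widehat u(\xi)|^2\,d\xi\in[0,\infty],$$ where $\widehat u$ is the unitary Fourier transform of $u$; so $\mathcal E^s_d(u)=\langle(-\Delta_{\mathbb R^d})^su,u\rangle$. Let $H^s(\mathbb R^d)$ be the space of real $u\in L^2(\mathbb R^d)$ with $\mathcal E^s_d(u)<\infty$, normed by $\|u\|^2=\mathcal E^s_d(u)+\|u\|^2_{L^2}$. For an open set $U\subset\mathbb R^d$ let $\widetilde H^s(U)$ be the subspace of those $u\in H^s(\mathbb R^d)$ that vanish a.e. on $\mathbb R^d\setminus\overline U$, with the same norm. Let $\omega\subset\mathbb R^n$ be a bounded open set (for instance a bounded Lipschitz domain), and let $B_1\subset\mathbb R^k$ be a bounded, open and convex neighbourhood of the origin; put $B_\ell=\ell B_1$ and $\Omega_\ell=\omega\times B_\ell\subset\mathbb R^{n+k}$ for $\ell>0$. Let $\ell\to\infty$ along an arbitrary divergent sequence of positive numbers. Let $f_\ell\in L^2(\Omega_\ell)$ and $f_\infty\in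 L^2(\omega)$ be such that the functions $(x,t)\mapsto f_\ell(x,\ell t)$ converge strongly in $L^2(\Omega_1)$ to $(x,t)\mapsto f_\infty(x)$. For $v\in\widetilde H^s(\Omega_1)$ and $u\in\widetilde H^s(\omega)$ define, with $\breve v_\ell(x,t)=v(x,t/\ell)$, $$I_\ell(v)=\frac12\,\frac{1}{|B_\ell|}\,\mathcal E^s_{n+k}(\breve v_\ell)-\frac1{|B_\ell|}\int_{\Omega_\ell}f_\ell\,\breve v_\ell\,dx\,dt,\qquad I_\infty(u)=\frac12\,\mathcal E^s_n(u)-\int_\omega f_\infty u\,dx,$$ and let $\rho(v)(x)=\frac1{|B_1|}\int_{B_1}v(x,t)\,dt$. Then $\rho$ maps $\widetilde H^s(\Omega_1)$ into $\widetilde H^s(\omega)$, and $I_\infty$ is the $\Gamma(\rho)$-limit of the functionals $I_\ell$, in the following sense. (i) For every $u\in\widetilde H^s(\omega)$ and every sequence $v_\ell\in\widetilde H^s(\Omega_1)$ such that $\rho(v_\ell)\rightharpoonup u$ weakly in $\widetilde H^s(\omega)$, $$I_\infty(u)\le\liminf_{\ell\to\infty}I_\ell(v_\ell).$$ (ii)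 For every $u\in\widetilde H^s(\omega)$ there is a sequence $\overline v_\ell\in\widetilde H^s(\Omega_1)$ such that $\rho(\overline v_\ell)\rightharpoonup u$ weakly in $\widetilde H^s(\omega)$ and $$\limsup_{\ell\to\infty}I_\ell(\overline v_\ell)\le I_\infty(u).$$ Moreover, there are functions $\varphi_\ell\in C^\infty_c(B_1)$, not depending on $u$, such that one can take $\overline v_\ell(x,t)=u(x)\,\varphi_\ell(t)$ for every $u$. -/

import Mathlib

open MeasureTheory Filter Topology FourierTransform
open scoped ENNReal Pointwise

section SobolevSpaces

variable {V : Type*} [NormedAddCommGroup V] [InnerProductSpace ℝ V] [FiniteDimensional ℝ V]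
  [MeasurableSpace V] [BorelSpace V]

/-- The class in `L²(V; ℂ)` of a real function `u ∈ L²(V)` (and `0` if `u ∉ L²(V)`). -/
noncomputable def complexLp (u : V → ℝ) : Lp (α := V) ℂ 2 :=
  open Classical in
  if h : MemLp (fun x => (u x : ℂ)) 2 (volume : Measure V) then h.toLp _ else 0

/-- The quadratic form `⟨(-Δ)ˢ u, u⟩` of the fractional Laplacian on `V`, as an extended
nonnegative number, for `u ∈ L²(V)`. With Mathlib's normalisation
`𝓕 u ξ = ∫ exp (-2 π i ⟪ξ, z⟫) u z dz` of the (`L²`) Fourier transform, the symbol of `(-Δ)ˢ` is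
`(2 π ‖ξ‖) ^ (2 s)`; after the change of variables `ζ = 2 π ξ` this is `∫ |ζ| ^ (2 s) |û(ζ)|² dζ`
with the unitary transform `û(ζ) = (2 π) ^ (-d/2) ∫ exp (-i ζ ⬝ z) u z dz`. -/
noncomputable def fracEnergyE (s : ℝ) (u : V → ℝ) : ℝ≥0∞ :=
  ∫⁻ ξ : V, ENNReal.ofReal ((2 * Real.pi * ‖ξ‖) ^ (2 * s)) * ‖(𝓕 (complexLp u)) ξ‖ₑ ^ 2

/-- `ℰˢ(u) = ⟨(-Δ)ˢ u, u⟩` as a real number; used for `u ∈ Hˢ(V)`, where it is finite. -/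
noncomputable def fracEnergy (s : ℝ) (u : V → ℝ) : ℝ := (fracEnergyE s u).toReal

theorem complexLp_of_memLp {u : V → ℝ} (hu : MemLp u 2 (volume : Measure V)) :
    complexLp u =ᵐ[volume] fun x => (u x : ℂ) := by
  have h : MemLp (fun x => (u x : ℂ)) 2 (volume : Measure V) := hu.ofReal
  rw [complexLp, dif_pos h]
  exact h.coeFn_toLp

theorem complexLp_add {u v : V → ℝ} (hu : MemLp u 2 (volume : Measure V))
    (hv : MemLp v 2 (volume : Measure V)) :
    complexLp (u + v) = complexLp u + complexLp v := by
  apply Lp.ext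
  filter_upwards [complexLp_of_memLp hu, complexLp_of_memLp hv, complexLp_of_memLp (hu.add hv),
    Lp.coeFn_add (complexLp u) (complexLp v)] with x h1 h2 h3 h4
  rw [h3, h4, Pi.add_apply (complexLp u : V → ℂ), h1, h2]
  simp

theorem complexLp_smul (c : ℝ) {u : V → ℝ} (hu : MemLp u 2 (volume : Measure V)) :
    complexLp (c • u) = (c : ℂ) • complexLp u := by
  apply Lp.ext
  filter_upwards [complexLp_of_memLp hu, complexLp_of_memLp (hu.const_smul c),
    Lp.coeFn_smul (c : ℂ) (complexLp u)] with x h1 h2 h3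
  rw [h2, h3, Pi.smul_apply (c : ℂ) (complexLp u : V → ℂ), h1]
  simp

theorem fracEnergyE_add_le (s : ℝ) {u v : V → ℝ} (hu : MemLp u 2 (volume : Measure V))
    (hv : MemLp v 2 (volume : Measure V)) :
    fracEnergyE s (u + v) ≤ 2 * (fracEnergyE s u + fracEnergyE s v) := by
  unfold fracEnergyE
  rw [complexLp_add hu hv, FourierTransform.fourier_add]
  have hmeas : ∀ w : Lp (α := V) ℂ 2, AEMeasurable (fun ξ : V =>
      ENNReal.ofReal ((2 * Real.pi * ‖ξ‖) ^ (2 * s)) * ‖w ξ‖ₑ ^ 2) volume := by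
    intro w
    refine AEMeasurable.mul ?_ ((Lp.aestronglyMeasurable w).enorm.pow_const 2)
    fun_prop
  rw [← lintegral_add_left' (hmeas _), ← lintegral_const_mul' _ _ (by simp)]
  apply lintegral_mono_ae
  filter_upwards [Lp.coeFn_add (𝓕 (complexLp u)) (𝓕 (complexLp v))] with ξ h
  rw [h, Pi.add_apply, ← mul_add, mul_left_comm]
  gcongr
  calc ‖(𝓕 (complexLp u)) ξ + (𝓕 (complexLp v)) ξ‖ₑ ^ 2
      ≤ (‖(𝓕 (complexLp u)) ξ‖ₑ + ‖(𝓕 (complexLp v)) ξ‖ₑ) ^ 2 := by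
        gcongr; exact enorm_add_le _ _
    _ ≤ _ := by
        have := ENNReal.rpow_add_le_mul_rpow_add_rpow
          ‖(𝓕 (complexLp u)) ξ‖ₑ ‖(𝓕 (complexLp v)) ξ‖ₑ (p := 2) (by norm_num)
        norm_num at this
        exact_mod_cast this

theorem fracEnergyE_smul (s c : ℝ) {u : V → ℝ} (hu : MemLp u 2 (volume : Measure V)) :
    fracEnergyE s (c • u) = ‖c‖ₑ ^ 2 * fracEnergyE s u := by
  unfold fracEnergyE
  rw [complexLp_smul c hu, FourierTransform.fourier_smul, ← lintegral_const_mul' _ _ (by simp)]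
  apply lintegral_congr_ae
  filter_upwards [Lp.coeFn_smul (c : ℂ) (𝓕 (complexLp u))] with ξ h
  rw [h, Pi.smul_apply, smul_eq_mul, enorm_mul, mul_pow, mul_left_comm]
  congr 2
  simp [← ofReal_norm]

/-- `H̃ˢ(U)`: the functions `u ∈ Hˢ(V)`, i.e. `u ∈ L²(V)` with `ℰˢ(u) < ∞`, that vanish
(almost everywhere) outside the closure of `U`. -/
noncomputable def HTilde (s : ℝ) (U : Set V) : Submodule ℝ (V → ℝ) where
  carrier := {u | MemLp u 2 volume ∧ fracEnergyE s u < ⊤ ∧ ∀ᵐ z, z ∉ closure U → u z = 0}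
  zero_mem' := by
    refine ⟨MemLp.zero, ?_, by simp⟩
    have h := fracEnergyE_smul s 0 (MemLp.zero : MemLp (0 : V → ℝ) 2 (volume : Measure V))
    rw [zero_smul] at h
    exact (h.trans (by simp)).trans_lt ENNReal.zero_lt_top
  add_mem' := by
    rintro u v ⟨hu, hu', hu''⟩ ⟨hv, hv', hv''⟩
    refine ⟨hu.add hv, (fracEnergyE_add_le s hu hv).trans_lt ?_, ?_⟩
    · exact ENNReal.mul_lt_top (by simp) (ENNReal.add_lt_top.2 ⟨hu', hv'⟩)
    · filter_upwards [hu'', hv''] with z h1 h2 h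
      simp [h1 h, h2 h]
  smul_mem' := by
    rintro c u ⟨hu, hu', hu''⟩
    refine ⟨hu.const_smul c, ?_, ?_⟩
    · rw [fracEnergyE_smul s c hu]
      exact ENNReal.mul_lt_top (by simp) hu'
    · filter_upwards [hu''] with z h1 h
      simp [h1 h]

/-- The norm of `Hˢ(V)`: `‖u‖² = ℰˢ(u) + ‖u‖²_{L²}`. -/
noncomputable def sobolevNorm (s : ℝ) (u : V → ℝ) : ℝ :=
  Real.sqrt (fracEnergy s u + ∫ z, u z ^ 2)

/-- Weak convergence `u j ⇀ u₀` in `H̃ˢ(U)`: all functions lie in `H̃ˢ(U)`, and `L (u j) → L u₀`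
for every linear functional `L` on `H̃ˢ(U)` that is bounded for the norm of `Hˢ`. -/
def WeakTendsto (s : ℝ) (U : Set V) (u : ℕ → V → ℝ) (u₀ : V → ℝ) : Prop :=
  ∃ (hu : ∀ j, u j ∈ HTilde s U) (hu₀ : u₀ ∈ HTilde s U),
    ∀ L : HTilde s U →ₗ[ℝ] ℝ, (∃ C : ℝ, ∀ w : HTilde s U, |L w| ≤ C * sobolevNorm s (w : V → ℝ)) →
      Tendsto (fun j => L ⟨u j, hu j⟩) atTop (𝓝 (L ⟨u₀, hu₀⟩))

end SobolevSpaces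

section Cylinders

/-- `ℝⁿ × ℝᵏ ≅ ℝⁿ⁺ᵏ`, pairs `(x, t)` with the Euclidean norm and Lebesgue measure. -/
abbrev ProdSpace (n k : ℕ) : Type :=
  WithLp 2 (EuclideanSpace ℝ (Fin n) × EuclideanSpace ℝ (Fin k))

/-- The cylinder `ω × B` in `ℝⁿ × ℝᵏ`. -/
def prodCylinder {n k : ℕ} (ω : Set (EuclideanSpace ℝ (Fin n))) (B : Set (EuclideanSpace ℝ (Fin k))) :
    Set (ProdSpace n k) :=
  {z | z.fst ∈ ω ∧ z.snd ∈ B}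

/-- The average `ρ(v)(x) = ⨍_B v(x, t) dt`. -/
noncomputable def avg {n k : ℕ} (B : Set (EuclideanSpace ℝ (Fin k))) (v : ProdSpace n k → ℝ) :
    EuclideanSpace ℝ (Fin n) → ℝ :=
  fun x => ⨍ t in B, v (WithLp.toLp 2 (x, t))

/-- The stretched function `(x, t) ↦ v(x, t / ℓ)`. -/
noncomputable def stretch {n k : ℕ} (ℓ : ℝ) (v : ProdSpace n k → ℝ) : ProdSpace n k → ℝ :=
  fun z => v (WithLp.toLp 2 (z.fst, ℓ⁻¹ • z.snd))

/-- The rescaled energy `I_ℓ(v) = ½ |ℓB|⁻¹ ℰˢ(v̆) - |ℓB|⁻¹ ∫_{ω × ℓB} g v̆` with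
`v̆(x, t) = v(x, t / ℓ)` and with load `g` on `ω × ℓB`. -/
noncomputable def rescaledEnergy {n k : ℕ} (s : ℝ) (ω : Set (EuclideanSpace ℝ (Fin n)))
    (B : Set (EuclideanSpace ℝ (Fin k))) (ℓ : ℝ) (g : ProdSpace n k → ℝ)
    (v : ProdSpace n k → ℝ) : ℝ :=
  1 / 2 * ((volume.real (ℓ • B))⁻¹ * fracEnergy s (stretch ℓ v))
    - (volume.real (ℓ • B))⁻¹ * ∫ z in prodCylinder ω (ℓ • B), g z * stretch ℓ v z

/-- The limit energy `I_∞(u) = ½ ℰˢ(u) - ∫_ω f_∞ u`. -/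
noncomputable def limitEnergy {n : ℕ} (s : ℝ) (ω : Set (EuclideanSpace ℝ (Fin n)))
    (f : EuclideanSpace ℝ (Fin n) → ℝ) (u : EuclideanSpace ℝ (Fin n) → ℝ) : ℝ :=
  1 / 2 * fracEnergy s u - ∫ x in ω, f x * u x

end Cylinders

/-! ### Fourier integrals on L¹ ∩ L², and weak convergence in `HTilde` -/

section FourierL2

variable {V : Type*} [NormedAddCommGroup V] [InnerProductSpace ℝ V] [FiniteDimensional ℝ V]
  [MeasurableSpace V] [BorelSpace V]

/-! After undoing the stretching, the dilation of `t` passes to the frequency side. The normalised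
energy of the stretched `v` becomes `|B|⁻¹ ∫ |(ξ, η/ℓ)|^(2s) |v̂(ξ, η)|²`, where `|B|` is a constant
and only the symbol depends on `ℓ` (`fracEnergy_stretch`, `anisoEnergy`). As `ℓ → ∞` the symbol
formally decreases to `|ξ|^(2s)`.

Lower bound. The symbol is at least `|ξ|^(2s)`. For fixed `ξ`, Plancherel in `t` and Cauchy–Schwarz
over `B` bound the squared transform of the average by the integral of `|v̂(ξ, ·)|²`. Hence the
energy of the average is at most the normalised energy of `v` (`fracEnergy_avg_le`), and weak lower
semicontinuity of the energy on `ω` applies. The load equals `∫ f_∞ ρ(v)` up to `δ_ℓ ‖v‖`, with `δ_ℓ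
→ 0` (`abs_rescaledEnergy_sub_le`). Weak convergence of the averages gives no bound on `‖v_ℓ‖`, so
this error is absorbed into the energy by a Poincaré inequality whose constant does not depend on
`ℓ` (`exists_poincare_cylinder`). It uses only the horizontal frequencies and the bounded section
`ω`.

Upper bound. For `v = u(x) φ(t)`, subadditivity of `τ ↦ τ^s` gives `|(ξ, η/ℓ)|^(2s) ≤ |ξ|^(2s) +
ℓ^(-2s) |η|^(2s)`, so the energy splits into `ℰ(u) ‖φ‖²` plus `ℓ^(-2s) ‖u‖² ℰ(φ)`
(`anisoEnergy_tensor_le`). It suffices that `0 ≤ φ_ℓ ≤ 1`, that the mean of `φ_ℓ` over `B` tends to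
1, and that `ℰ(φ_ℓ)` grows more slowly than `ℓ^(2s)`; such cut-offs are independent of `u`
(`exists_cutoff_sequence`). Their averages are scalar multiples of `u`, so weak convergence is
immediate. -/

theorem continuous_fourier_of_integrable {f : V → ℂ} (h1 : Integrable f) :
    Continuous (𝓕 f : V → ℂ) :=
  VectorFourier.fourierIntegral_continuous Real.continuous_fourierChar
    (by exact continuous_inner) h1

/-- On `L¹ ∩ L²` the `L²` Fourier transform is given by the Fourier integral. -/
theorem fourier_toLp_ae_eq {f : V → ℂ} (h1 : Integrable f) (h2 : MemLp f 2 (volume : Measure V)) :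
    (𝓕 (h2.toLp _) : Lp ℂ 2 (volume : Measure V)) =ᵐ[volume] (𝓕 f : V → ℂ) := by
  apply ae_eq_of_integral_contDiff_smul_eq
  · exact (Lp.memLp _).locallyIntegrable (by norm_num)
  · exact (continuous_fourier_of_integrable h1).locallyIntegrable
  intro g hg hgc
  have hgc' : HasCompactSupport fun x => (g x : ℂ) := hgc.comp_left (g := fun r : ℝ => (r : ℂ)) rfl
  set G : SchwartzMap V ℂ := hgc'.toSchwartzMap (Complex.ofRealCLM.contDiff.comp hg) with hG
  have hGx : ∀ x, G x = (g x : ℂ) := fun x => rfl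
  -- Duality: the `L²` transform agrees with the distributional one, so the pairing with `G` moves
  -- the transform onto `G`. The multiplication formula for integrable functions then moves it back
  -- to `f`.
  have key := congrArg (fun T => T G) (Lp.fourier_toTemperedDistribution_eq (h2.toLp _))
  simp only [TemperedDistribution.fourier_apply, Lp.toTemperedDistribution_apply] at key
  have e1 : ∫ x, g x • (𝓕 (h2.toLp _) : Lp ℂ 2 (volume : Measure V)) x
      = ∫ x, G x • (𝓕 (h2.toLp _) : Lp ℂ 2 (volume : Measure V)) x := by
    simp [hGx]
  rw [e1, ← key]
  have e2 : ∫ x, (𝓕 G) x • (h2.toLp _ : Lp ℂ 2 (volume : Measure V)) x = ∫ x, (𝓕 (G : V → ℂ)) x • f x := by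
    apply integral_congr_ae
    filter_upwards [h2.coeFn_toLp] with x hx
    rw [hx, SchwartzMap.fourier_coe]
  rw [e2]
  have := VectorFourier.integral_fourierIntegral_smul_eq_flip (μ := (volume : Measure V))
    (ν := (volume : Measure V)) (L := innerₗ V) (f := (G : V → ℂ)) (g := f)
    Real.continuous_fourierChar (by exact continuous_inner) G.integrable h1
  refine Eq.trans ?_ (this.trans ?_)
  · rfl
  · apply integral_congr_ae
    filter_upwards with x
    rw [hGx, flip_innerₗ]
    simp only [smul_eq_mul, Complex.real_smul]
    rfl

theorem lintegral_enorm_sq_fourier {f : V → ℂ} (h1 : Integrable f) (h2 : MemLp f 2 (volume : Measure V)) :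
    ∫⁻ ξ, ‖𝓕 f ξ‖ₑ ^ 2 = ∫⁻ x, ‖f x‖ₑ ^ 2 := by
  have h := Lp.norm_fourier_eq (h2.toLp _)
  have h' : ‖(𝓕 (h2.toLp _) : Lp ℂ 2 (volume : Measure V))‖ₑ = ‖h2.toLp f‖ₑ := by
    rw [← ofReal_norm, ← ofReal_norm, h]
  rw [Lp.enorm_def, Lp.enorm_def, eLpNorm_congr_ae (fourier_toLp_ae_eq h1 h2),
    eLpNorm_congr_ae h2.coeFn_toLp] at h'
  have := eLpNorm_nnreal_pow_eq_lintegral (p := 2) (μ := (volume : Measure V)) (f := f) (by norm_num)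
  have t2 := eLpNorm_nnreal_pow_eq_lintegral (p := 2) (μ := (volume : Measure V))
    (f := (𝓕 f : V → ℂ)) (by norm_num)
  norm_num at this t2
  rw [← this, ← t2, h']

/-- The energy is defined through the abstract `L²` transform. Fubini and changes of variable need
the integral formula, which is available here because functions supported in bounded sets are
integrable. -/
theorem fracEnergyE_eq_lintegral_fourier (s : ℝ) {u : V → ℝ} (h1 : Integrable u)
    (h2 : MemLp u 2 (volume : Measure V)) :
    fracEnergyE s u = ∫⁻ ξ : V, ENNReal.ofReal ((2 * Real.pi * ‖ξ‖) ^ (2 * s)) *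
      ‖𝓕 (fun x => (u x : ℂ)) ξ‖ₑ ^ 2 := by
  have h : MemLp (fun x => (u x : ℂ)) 2 (volume : Measure V) := h2.ofReal
  unfold fracEnergyE
  rw [complexLp, dif_pos h]
  apply lintegral_congr_ae
  filter_upwards [fourier_toLp_ae_eq h1.ofReal h] with ξ hξ
  simp only [Complex.coe_algebraMap] at hξ ⊢
  exact congrArg (fun z : ℂ => _ * ‖z‖ₑ ^ 2) hξ

theorem integrable_of_ae_zero {u : V → ℝ} (h2 : MemLp u 2 (volume : Measure V)) {K : Set V}
    (hK : MeasurableSet K) (hKf : volume K ≠ ⊤) (h0 : ∀ᵐ z, z ∉ K → u z = 0) :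
    Integrable u := by
  have : Integrable (K.indicator u) := by
    rw [integrable_indicator_iff hK]
    have : IsFiniteMeasure (volume.restrict K) := ⟨by simpa using hKf.lt_top⟩
    exact (h2.mono_measure Measure.restrict_le_self).integrable (by norm_num)
  apply this.congr
  filter_upwards [h0] with z hz
  by_cases h : z ∈ K
  · simp [h]
  · simp [h, hz h]

theorem integrable_of_mem_HTilde {s : ℝ} {U : Set V} (hU : Bornology.IsBounded U) {u : V → ℝ}
    (hu : u ∈ HTilde s U) : Integrable u :=
  integrable_of_ae_zero hu.1 isClosed_closure.measurableSet
    (hU.closure.measure_lt_top).ne hu.2.2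

/-- The weighted Fourier transform `ξ ↦ (2 π ‖ξ‖) ^ s û(ξ)`. -/
noncomputable def weightedFourier (s : ℝ) (u : V → ℝ) (ξ : V) : ℂ :=
  (((2 * Real.pi * ‖ξ‖) ^ s : ℝ) : ℂ) * (𝓕 (complexLp u)) ξ

theorem enorm_weightedFourier_sq (s : ℝ) (u : V → ℝ) (ξ : V) :
    ‖weightedFourier s u ξ‖ₑ ^ 2 =
      ENNReal.ofReal ((2 * Real.pi * ‖ξ‖) ^ (2 * s)) * ‖(𝓕 (complexLp u)) ξ‖ₑ ^ 2 := by
  have h0 : 0 ≤ 2 * Real.pi * ‖ξ‖ := by positivity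
  rw [weightedFourier, enorm_mul, mul_pow, mul_comm 2 s, Real.rpow_mul h0,
    ← ofReal_norm, Complex.norm_real, Real.norm_of_nonneg (by positivity),
    ← ENNReal.ofReal_pow (by positivity)]
  norm_cast

theorem aestronglyMeasurable_weightedFourier (s : ℝ) (u : V → ℝ) :
    AEStronglyMeasurable (weightedFourier s u) volume := by
  refine AEStronglyMeasurable.mul ?_ (Lp.aestronglyMeasurable _)
  have : Measurable fun ξ : V => (((2 * Real.pi * ‖ξ‖) ^ s : ℝ) : ℂ) := by fun_prop
  exact this.aestronglyMeasurable

theorem eLpNorm_weightedFourier_sq (s : ℝ) (u : V → ℝ) :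
    eLpNorm (weightedFourier s u) 2 volume ^ 2 = fracEnergyE s u := by
  have := eLpNorm_nnreal_pow_eq_lintegral (p := 2) (μ := (volume : Measure V))
    (f := weightedFourier s u) (by norm_num)
  norm_num at this
  rw [this, fracEnergyE]
  simp_rw [enorm_weightedFourier_sq]

theorem memLp_weightedFourier {s : ℝ} {u : V → ℝ} (h : fracEnergyE s u < ⊤) :
    MemLp (weightedFourier s u) 2 volume := by
  refine ⟨aestronglyMeasurable_weightedFourier s u, ?_⟩
  rw [← eLpNorm_weightedFourier_sq] at h
  by_contra h'
  simp [not_lt_top_iff.1 h'] at h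

/-- The isometric embedding of `H̃ˢ(U)` with the seminorm `(ℰˢ)^{1/2}` into `L²`. -/
noncomputable def weightedFourierₗ (s : ℝ) (U : Set V) : HTilde s U →ₗ[ℝ] Lp ℂ 2 (volume : Measure V) where
  toFun u := (memLp_weightedFourier u.2.2.1).toLp _
  map_add' u v := by
    rw [← MemLp.toLp_add, MemLp.toLp_eq_toLp_iff]
    filter_upwards [Lp.coeFn_add (𝓕 (complexLp (u : V → ℝ))) (𝓕 (complexLp (v : V → ℝ)))] with ξ h
    simp only [weightedFourier, Submodule.coe_add, Pi.add_apply]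
    rw [complexLp_add u.2.1 v.2.1, FourierTransform.fourier_add, h, Pi.add_apply, mul_add]
  map_smul' c u := by
    rw [RingHom.id_apply, ← MemLp.toLp_const_smul, MemLp.toLp_eq_toLp_iff]
    filter_upwards [Lp.coeFn_smul (c : ℂ) (𝓕 (complexLp (u : V → ℝ)))] with ξ h
    simp only [weightedFourier, Submodule.coe_smul, Pi.smul_apply]
    rw [complexLp_smul c u.2.1, FourierTransform.fourier_smul, h, Pi.smul_apply]
    simp only [smul_eq_mul, Complex.real_smul]
    ring

theorem norm_weightedFourierₗ_sq {s : ℝ} {U : Set V} (u : HTilde s U) :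
    ‖weightedFourierₗ s U u‖ ^ 2 = fracEnergy s (u : V → ℝ) := by
  rw [fracEnergy, ← eLpNorm_weightedFourier_sq, ENNReal.toReal_pow]
  congr 1
  exact Lp.norm_toLp _ (memLp_weightedFourier u.2.2.1)

/-- Weak lower semicontinuity of `ℰˢ`, with an explicit convergent minorant. -/
theorem WeakTendsto.exists_tendsto_fracEnergy {s : ℝ} {U : Set V} {u : ℕ → V → ℝ} {u₀ : V → ℝ}
    (h : WeakTendsto s U u u₀) :
    ∃ a : ℕ → ℝ, Tendsto a atTop (𝓝 (fracEnergy s u₀)) ∧ ∀ j, a j ≤ fracEnergy s (u j) := by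
  obtain ⟨hu, hu₀, h⟩ := h
  set T := weightedFourierₗ s U
  let L : HTilde s U →ₗ[ℝ] ℝ :=
    { toFun := fun w => (inner ℂ (T ⟨u₀, hu₀⟩) (T w)).re
      map_add' := fun v w => by rw [map_add, inner_add_right, Complex.add_re]
      map_smul' := fun c w => by
        rw [map_smul, RingHom.id_apply, ← algebraMap_smul ℂ c (T w), inner_smul_right,
          Complex.coe_algebraMap, Complex.re_ofReal_mul, smul_eq_mul] }
  have hL : ∀ w, L w = (inner ℂ (T ⟨u₀, hu₀⟩) (T w)).re := fun w => rfl
  have hLu : L ⟨u₀, hu₀⟩ = fracEnergy s u₀ := by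
    rw [hL, ← norm_weightedFourierₗ_sq ⟨u₀, hu₀⟩]
    exact inner_self_eq_norm_sq (𝕜 := ℂ) _
  -- The minorant is the tangent `2 Re⟨T u₀, T u_j⟩ - ‖T u₀‖²`, which lies below `‖T u_j‖²` because
  -- `‖T u₀ - T u_j‖² ≥ 0`. Using it avoids any boundedness assumption on the energies.
  refine ⟨fun j => 2 * L ⟨u j, hu j⟩ - fracEnergy s u₀, ?_, fun j => ?_⟩
  · have := (h L ⟨‖T ⟨u₀, hu₀⟩‖, fun w => ?_⟩).const_mul 2 |>.sub_const (fracEnergy s u₀)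
    · rw [hLu] at this
      convert! this using 2
      ring
    · rw [hL]
      refine (Complex.abs_re_le_norm _).trans ((norm_inner_le_norm _ _).trans ?_)
      gcongr
      apply Real.le_sqrt_of_sq_le
      rw [norm_weightedFourierₗ_sq]
      have : 0 ≤ ∫ z, (w : V → ℝ) z ^ 2 := integral_nonneg fun _ => sq_nonneg _
      linarith
  · have h1 := norm_sub_sq (𝕜 := ℂ) (T ⟨u₀, hu₀⟩) (T ⟨u j, hu j⟩)
    have h2 := norm_weightedFourierₗ_sq (s := s) (U := U) ⟨u₀, hu₀⟩
    have h3 := norm_weightedFourierₗ_sq (s := s) (U := U) ⟨u j, hu j⟩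
    have h4 := sq_nonneg ‖T ⟨u₀, hu₀⟩ - T ⟨u j, hu j⟩‖
    simp only [hL, T] at *
    change _ = _ - 2 * Complex.re _ + _ at h1
    linarith

theorem sqrt_integral_sq_le_sobolevNorm {s : ℝ} {u : V → ℝ} :
    Real.sqrt (∫ z, u z ^ 2) ≤ sobolevNorm s u := by
  apply Real.sqrt_le_sqrt
  have : 0 ≤ fracEnergy s u := ENNReal.toReal_nonneg
  linarith

theorem abs_integral_mul_le_eLpNorm_mul_eLpNorm {α : Type*} [MeasurableSpace α] {μ : Measure α} {f g : α → ℝ}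
    (hf : MemLp f 2 μ) (hg : MemLp g 2 μ) :
    |∫ x, f x * g x ∂μ| ≤ (eLpNorm f 2 μ).toReal * (eLpNorm g 2 μ).toReal := by
  have h := abs_real_inner_le_norm (hf.toLp f) (hg.toLp g)
  rw [L2.inner_def, Lp.norm_toLp, Lp.norm_toLp] at h
  convert! h using 2
  apply integral_congr_ae
  filter_upwards [hf.coeFn_toLp, hg.coeFn_toLp] with x h1 h2
  rw [h1, h2]
  simp [mul_comm]

theorem toReal_eLpNorm_two_sq {α : Type*} [MeasurableSpace α] {μ : Measure α} {f : α → ℝ}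
    (hf : MemLp f 2 μ) : (eLpNorm f 2 μ).toReal ^ 2 = ∫ x, f x ^ 2 ∂μ := by
  have h := real_inner_self_eq_norm_sq (hf.toLp f)
  rw [L2.inner_def, Lp.norm_toLp] at h
  rw [← h]
  apply integral_congr_ae
  filter_upwards [hf.coeFn_toLp] with x h1
  rw [h1]
  simp [sq]

/-- Pairing with an `L²` function is bounded for the `L²` norm, hence for the Sobolev norm, so it is
an admissible test functional. -/
theorem WeakTendsto.tendsto_setIntegral_mul {s : ℝ} {U : Set V} {u : ℕ → V → ℝ} {u₀ : V → ℝ}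
    (h : WeakTendsto s U u u₀) {A : Set V} {f : V → ℝ} (hf : MemLp f 2 (volume.restrict A)) :
    Tendsto (fun j => ∫ x in A, f x * u j x) atTop (𝓝 (∫ x in A, f x * u₀ x)) := by
  obtain ⟨hu, hu₀, h⟩ := h
  have hm : ∀ w : HTilde s U, MemLp (w : V → ℝ) 2 (volume.restrict A) :=
    fun w => w.2.1.mono_measure Measure.restrict_le_self
  have hi : ∀ w : HTilde s U, Integrable (fun x => f x * (w : V → ℝ) x) (volume.restrict A) :=
    fun w => hf.integrable_mul (hm w)
  let L : HTilde s U →ₗ[ℝ] ℝ :=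
    { toFun := fun w => ∫ x in A, f x * (w : V → ℝ) x
      map_add' := fun v w => by
        rw [← integral_add (hi v) (hi w)]
        simp [mul_add]
      map_smul' := fun c w => by
        rw [RingHom.id_apply, smul_eq_mul, ← integral_const_mul]
        simp [mul_left_comm] }
  refine h L ⟨(eLpNorm f 2 (volume.restrict A)).toReal, fun w => ?_⟩
  refine (abs_integral_mul_le_eLpNorm_mul_eLpNorm hf (hm w)).trans ?_
  gcongr
  refine le_trans ?_ sqrt_integral_sq_le_sobolevNorm
  rw [← toReal_eLpNorm_two_sq w.2.1, Real.sqrt_sq ENNReal.toReal_nonneg]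
  exact ENNReal.toReal_mono w.2.1.2.ne (eLpNorm_mono_measure _ Measure.restrict_le_self)

end FourierL2

/-! ### Slicing the Fourier transform, and Poincaré's inequality in the first variable -/

section Slicing

theorem measurableEmbedding_toLp_prod {E F : Type*} [MeasurableSpace E] [MeasurableSpace F] :
    MeasurableEmbedding (WithLp.toLp 2 : E × F → WithLp 2 (E × F)) :=
  (MeasurableEquiv.toLp 2 (E × F)).measurableEmbedding

section PartialFourier

variable {E F : Type*} [NormedAddCommGroup E] [InnerProductSpace ℝ E] [FiniteDimensional ℝ E]
  [MeasurableSpace E] [BorelSpace E]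

/-- The Fourier transform in the first variable only. -/
noncomputable def partialFourier (v : WithLp 2 (E × F) → ℂ) (ξ : E) (t : F) : ℂ :=
  𝓕 (fun x : E => v (WithLp.toLp 2 (x, t))) ξ

theorem partialFourier_eq (v : WithLp 2 (E × F) → ℂ) (ξ : E) (t : F) :
    partialFourier v ξ t =
      ∫ x : E, Real.fourierChar (-inner ℝ x ξ) • v (WithLp.toLp 2 (x, t)) := by
  rw [partialFourier, Real.fourier_eq]

end PartialFourier

variable {E F : Type*} [NormedAddCommGroup E] [InnerProductSpace ℝ E] [FiniteDimensional ℝ E]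
  [MeasurableSpace E] [BorelSpace E] [NormedAddCommGroup F] [InnerProductSpace ℝ F]
  [FiniteDimensional ℝ F] [MeasurableSpace F] [BorelSpace F]

theorem integrable_comp_toLp_prod {G : Type*} [NormedAddCommGroup G] {v : WithLp 2 (E × F) → G}
    (hv : Integrable v) :
    Integrable (fun p : E × F => v (WithLp.toLp 2 p)) (volume.prod volume) :=
  ((WithLp.volume_preserving_toLp E F).integrable_comp_emb measurableEmbedding_toLp_prod).2 hv

theorem aestronglyMeasurable_comp_toLp_prod {G : Type*} [TopologicalSpace G]
    {v : WithLp 2 (E × F) → G} (hv : AEStronglyMeasurable v volume) :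
    AEStronglyMeasurable (fun p : E × F => v (WithLp.toLp 2 p)) (volume.prod volume) :=
  hv.comp_quasiMeasurePreserving
    (WithLp.volume_preserving_toLp E F).quasiMeasurePreserving

theorem ae_toLp_prod {p : WithLp 2 (E × F) → Prop} (h : ∀ᵐ z, p z) :
    ∀ᵐ q : E × F ∂(volume.prod volume), p (WithLp.toLp 2 q) :=
  (WithLp.volume_preserving_toLp E F).quasiMeasurePreserving.ae h

theorem integral_withLp_prod {G : Type*} [NormedAddCommGroup G] [NormedSpace ℝ G]
    (v : WithLp 2 (E × F) → G) :
    ∫ z, v z = ∫ p : E × F, v (WithLp.toLp 2 p) ∂(volume.prod volume) :=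
  ((WithLp.volume_preserving_toLp E F).integral_comp measurableEmbedding_toLp_prod v).symm

theorem lintegral_withLp_prod' (f : WithLp 2 (E × F) → ℝ≥0∞) :
    ∫⁻ z, f z = ∫⁻ p : E × F, f (WithLp.toLp 2 p) ∂(volume.prod volume) :=
  ((WithLp.volume_preserving_toLp E F).lintegral_comp_emb measurableEmbedding_toLp_prod f).symm

theorem aemeasurable_comp_toLp_prod {f : WithLp 2 (E × F) → ℝ≥0∞} (hf : AEMeasurable f) :
    AEMeasurable (fun p : E × F => f (WithLp.toLp 2 p)) (volume.prod volume) :=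
  hf.comp_quasiMeasurePreserving (WithLp.volume_preserving_toLp E F).quasiMeasurePreserving

theorem lintegral_withLp_prod {f : WithLp 2 (E × F) → ℝ≥0∞} (hf : AEMeasurable f) :
    ∫⁻ z, f z = ∫⁻ x : E, ∫⁻ t : F, f (WithLp.toLp 2 (x, t)) := by
  rw [lintegral_withLp_prod', lintegral_prod _ (aemeasurable_comp_toLp_prod hf)]

theorem lintegral_withLp_prod_symm {f : WithLp 2 (E × F) → ℝ≥0∞} (hf : AEMeasurable f) :
    ∫⁻ z, f z = ∫⁻ t : F, ∫⁻ x : E, f (WithLp.toLp 2 (x, t)) := by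
  rw [lintegral_withLp_prod', lintegral_prod_symm _ (aemeasurable_comp_toLp_prod hf)]

theorem sq_lintegral_le {α : Type*} [MeasurableSpace α] {μ : Measure α} {f : α → ℝ≥0∞}
    (hf : AEMeasurable f μ) : (∫⁻ a, f a ∂μ) ^ 2 ≤ μ Set.univ * ∫⁻ a, f a ^ 2 ∂μ := by
  have h := ENNReal.lintegral_mul_le_Lp_mul_Lq μ Real.HolderConjugate.two_two hf
    (aemeasurable_const (b := 1))
  simp only [Pi.mul_apply, mul_one, ENNReal.one_rpow, lintegral_const, one_mul] at h
  have h2 := pow_le_pow_left' h 2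
  rw [mul_pow, ← ENNReal.rpow_natCast, ← ENNReal.rpow_natCast, ← ENNReal.rpow_natCast,
    ← ENNReal.rpow_mul, ← ENNReal.rpow_mul] at h2
  norm_num at h2
  rwa [mul_comm] at h2

theorem integrable_fourierChar_smul_prod {v : WithLp 2 (E × F) → ℂ} (hv : Integrable v) (ξ : E) :
    Integrable (fun p : E × F => Real.fourierChar (-inner ℝ p.1 ξ) • v (WithLp.toLp 2 p))
      (volume.prod volume) := by
  have h := integrable_comp_toLp_prod hv
  refine h.norm.mono' (AEStronglyMeasurable.smul ?_ h.aestronglyMeasurable) ?_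
  · have : Continuous fun p : E × F => Real.fourierChar (-inner ℝ p.1 ξ) :=
      Real.continuous_fourierChar.comp (by fun_prop)
    exact (continuous_subtype_val.comp this).aestronglyMeasurable
  · filter_upwards with p
    simp

theorem integrable_partialFourier {v : WithLp 2 (E × F) → ℂ} (hv : Integrable v) (ξ : E) :
    Integrable (partialFourier v ξ) := by
  have := (integrable_fourierChar_smul_prod hv ξ).integral_prod_right
  refine this.congr ?_
  filter_upwards with t
  rw [partialFourier_eq]

/-- The character of the product splits as a product of characters, so this is Fubini. -/
theorem fourier_partialFourier {v : WithLp 2 (E × F) → ℂ} (hv : Integrable v) (ξ : E) (η : F) :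
    𝓕 (partialFourier v ξ) η = 𝓕 v (WithLp.toLp 2 (ξ, η)) := by
  have h1 : Integrable (fun p : E × F => Real.fourierChar (-inner ℝ p.2 η) •
      (Real.fourierChar (-inner ℝ p.1 ξ) • v (WithLp.toLp 2 p))) (volume.prod volume) := by
    have h := integrable_fourierChar_smul_prod hv ξ
    refine h.norm.mono' (AEStronglyMeasurable.smul ?_ h.aestronglyMeasurable) ?_
    · have : Continuous fun p : E × F => Real.fourierChar (-inner ℝ p.2 η) :=
        Real.continuous_fourierChar.comp (by fun_prop)
      exact (continuous_subtype_val.comp this).aestronglyMeasurable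
    · filter_upwards with p
      simp
  rw [Real.fourier_eq, Real.fourier_eq, integral_withLp_prod]
  have h2 : ∀ p : E × F, Real.fourierChar (-inner ℝ (WithLp.toLp 2 p : WithLp 2 (E × F))
      (WithLp.toLp 2 (ξ, η))) • v (WithLp.toLp 2 p) = Real.fourierChar (-inner ℝ p.2 η) •
      (Real.fourierChar (-inner ℝ p.1 ξ) • v (WithLp.toLp 2 p)) := fun p => by
    rw [← mul_smul, ← AddChar.map_add_eq_mul, WithLp.prod_inner_apply]
    congr 2
    simp only
    ring
  simp_rw [h2]
  rw [integral_prod_symm _ h1]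
  apply integral_congr_ae
  filter_upwards with t
  rw [partialFourier_eq, Circle.smul_def, smul_eq_mul, ← integral_const_mul]
  rfl

/-- Cauchy-Schwarz in the first variable for a function supported in `A × F`. -/
theorem ae_enorm_partialFourier_sq_le {v : WithLp 2 (E × F) → ℂ}
    (hv : AEStronglyMeasurable v volume) {A : Set E} (hA : MeasurableSet A)
    (h0 : ∀ᵐ z : WithLp 2 (E × F), z.fst ∉ A → v z = 0) :
    ∀ᵐ t : F, ∀ ξ : E, ‖partialFourier v ξ t‖ₑ ^ 2 ≤
      volume A * ∫⁻ x : E, ‖v (WithLp.toLp 2 (x, t))‖ₑ ^ 2 := by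
  have h1 : ∀ᵐ t : F, ∀ᵐ x : E, x ∉ A → v (WithLp.toLp 2 (x, t)) = 0 := by
    have := (Measure.measurePreserving_swap (μ := (volume : Measure F))
      (ν := (volume : Measure E))).quasiMeasurePreserving.ae (ae_toLp_prod h0)
    exact Measure.ae_ae_of_ae_prod this
  have h2 : ∀ᵐ t : F, AEStronglyMeasurable (fun x : E => v (WithLp.toLp 2 (x, t))) volume :=
    (aestronglyMeasurable_comp_toLp_prod hv).prod_swap.prodMk_left
  filter_upwards [h1, h2] with t h1 h2 ξ
  have e1 : ‖partialFourier v ξ t‖ₑ ≤ ∫⁻ x : E in A, ‖v (WithLp.toLp 2 (x, t))‖ₑ := by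
    rw [partialFourier_eq]
    refine (enorm_integral_le_lintegral_enorm _).trans ?_
    rw [← lintegral_indicator hA]
    apply lintegral_mono_ae
    filter_upwards [h1] with x hx
    by_cases hxA : x ∈ A
    · rw [Set.indicator_of_mem hxA, Circle.smul_def, smul_eq_mul, enorm_mul, ← ofReal_norm,
        Circle.norm_coe, ENNReal.ofReal_one, one_mul]
    · simp [hxA, hx hxA]
  calc ‖partialFourier v ξ t‖ₑ ^ 2 ≤ (∫⁻ x : E in A, ‖v (WithLp.toLp 2 (x, t))‖ₑ) ^ 2 := by gcongr
    _ ≤ _ := sq_lintegral_le h2.enorm.restrict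
    _ ≤ _ := by
      rw [Measure.restrict_apply_univ]
      gcongr
      exact Measure.restrict_le_self

/-- Finite measure of `A` makes this a bound for every `ξ`, not merely almost every one. The slices
are therefore in `L²`, and Plancherel in `t` can be used pointwise in `ξ`. -/
theorem lintegral_enorm_partialFourier_sq_le {v : WithLp 2 (E × F) → ℂ}
    (hv : AEStronglyMeasurable v volume) {A : Set E} (hA : MeasurableSet A)
    (h0 : ∀ᵐ z : WithLp 2 (E × F), z.fst ∉ A → v z = 0) (ξ : E) :
    ∫⁻ t : F, ‖partialFourier v ξ t‖ₑ ^ 2 ≤ volume A * ∫⁻ z, ‖v z‖ₑ ^ 2 := by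
  have hm : AEMeasurable (fun z : WithLp 2 (E × F) => ‖v z‖ₑ ^ 2) := hv.enorm.pow_const 2
  rw [lintegral_withLp_prod_symm hm, ← lintegral_const_mul'']
  · apply lintegral_mono_ae
    filter_upwards [ae_enorm_partialFourier_sq_le hv hA h0] with t ht
    exact ht ξ
  · exact (aemeasurable_comp_toLp_prod hm).prod_swap.lintegral_prod_right'

theorem lintegral_enorm_sq_eq_eLpNorm_sq {α G : Type*} [MeasurableSpace α] [NormedAddCommGroup G]
    (μ : Measure α) (f : α → G) : ∫⁻ x, ‖f x‖ₑ ^ 2 ∂μ = eLpNorm f 2 μ ^ 2 := by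
  have := eLpNorm_nnreal_pow_eq_lintegral (p := 2) (μ := μ) (f := f) (by norm_num)
  norm_num at this
  exact this.symm

theorem memLp_two_of_lintegral_lt_top {α G : Type*} [MeasurableSpace α] [NormedAddCommGroup G]
    {μ : Measure α} {f : α → G} (hf : AEStronglyMeasurable f μ)
    (h : ∫⁻ x, ‖f x‖ₑ ^ 2 ∂μ < ⊤) : MemLp f 2 μ := by
  refine ⟨hf, ?_⟩
  rw [lintegral_enorm_sq_eq_eLpNorm_sq] at h
  by_contra h'
  simp [not_lt_top_iff.1 h'] at h

theorem lintegral_enorm_sq_lt_top {α G : Type*} [MeasurableSpace α] [NormedAddCommGroup G]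
    {μ : Measure α} {f : α → G} (h : MemLp f 2 μ) : ∫⁻ x, ‖f x‖ₑ ^ 2 ∂μ < ⊤ := by
  rw [lintegral_enorm_sq_eq_eLpNorm_sq]
  exact ENNReal.pow_lt_top h.2

/-- Plancherel's theorem in the second variable. -/
theorem lintegral_enorm_fourier_sq_slice {v : WithLp 2 (E × F) → ℂ}
    (h1 : Integrable v) (h2 : MemLp v 2 volume) {A : Set E} (hA : MeasurableSet A)
    (hAf : volume A ≠ ⊤) (h0 : ∀ᵐ z : WithLp 2 (E × F), z.fst ∉ A → v z = 0) (ξ : E) :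
    ∫⁻ η : F, ‖𝓕 v (WithLp.toLp 2 (ξ, η))‖ₑ ^ 2 = ∫⁻ t : F, ‖partialFourier v ξ t‖ₑ ^ 2 := by
  have hi := integrable_partialFourier h1 ξ
  have hL : MemLp (partialFourier v ξ) 2 volume := by
    refine memLp_two_of_lintegral_lt_top hi.aestronglyMeasurable ?_
    refine (lintegral_enorm_partialFourier_sq_le h1.aestronglyMeasurable hA h0 ξ).trans_lt ?_
    exact ENNReal.mul_lt_top hAf.lt_top (lintegral_enorm_sq_lt_top h2)
  rw [← lintegral_enorm_sq_fourier hi hL]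
  simp_rw [fourier_partialFourier h1]

theorem lintegral_enorm_fourier_sq_slice_le {v : WithLp 2 (E × F) → ℂ}
    (h1 : Integrable v) (h2 : MemLp v 2 volume) {A : Set E} (hA : MeasurableSet A)
    (hAf : volume A ≠ ⊤) (h0 : ∀ᵐ z : WithLp 2 (E × F), z.fst ∉ A → v z = 0) (ξ : E) :
    ∫⁻ η : F, ‖𝓕 v (WithLp.toLp 2 (ξ, η))‖ₑ ^ 2 ≤ volume A * ∫⁻ z, ‖v z‖ₑ ^ 2 := by
  rw [lintegral_enorm_fourier_sq_slice h1 h2 hA hAf h0]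
  exact lintegral_enorm_partialFourier_sq_le h1.aestronglyMeasurable hA h0 ξ

theorem fourier_setIntegral_eq {v : WithLp 2 (E × F) → ℂ} (h1 : Integrable v) (C : Set F)
    (ξ : E) : 𝓕 (fun x : E => ∫ t in C, v (WithLp.toLp 2 (x, t))) ξ =
      ∫ t in C, partialFourier v ξ t := by
  have h := integrable_fourierChar_smul_prod h1 ξ
  have h' : Integrable (fun p : E × F => Real.fourierChar (-inner ℝ p.1 ξ) •
      v (WithLp.toLp 2 p)) (volume.prod (volume.restrict C)) := by
    refine h.mono_measure ?_
    rw [← Measure.restrict_univ (μ := (volume : Measure E)), Measure.prod_restrict,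
      Measure.restrict_univ]
    exact Measure.restrict_le_self
  rw [Real.fourier_eq]
  simp_rw [partialFourier_eq]
  rw [← integral_integral_swap h']
  apply integral_congr_ae
  filter_upwards with x
  rw [Circle.smul_def, smul_eq_mul, ← integral_const_mul]
  rfl

/-- Transforming in `x` commutes with integrating over `C`. Cauchy–Schwarz over `C` costs the factor
`volume C`, and Plancherel in `t` turns the slice into the full transform. -/
theorem enorm_fourier_setIntegral_sq_le {v : WithLp 2 (E × F) → ℂ}
    (h1 : Integrable v) (h2 : MemLp v 2 volume) {A : Set E} (hA : MeasurableSet A)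
    (hAf : volume A ≠ ⊤) (h0 : ∀ᵐ z : WithLp 2 (E × F), z.fst ∉ A → v z = 0)
    (C : Set F) (ξ : E) :
    ‖𝓕 (fun x : E => ∫ t in C, v (WithLp.toLp 2 (x, t))) ξ‖ₑ ^ 2 ≤
      volume C * ∫⁻ η : F, ‖𝓕 v (WithLp.toLp 2 (ξ, η))‖ₑ ^ 2 := by
  rw [fourier_setIntegral_eq h1, lintegral_enorm_fourier_sq_slice h1 h2 hA hAf h0]
  have hm := (integrable_partialFourier h1 ξ).aestronglyMeasurable.enorm
  calc _ ≤ (∫⁻ t in C, ‖partialFourier v ξ t‖ₑ) ^ 2 := by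
        gcongr; exact enorm_integral_le_lintegral_enorm _
    _ ≤ _ := sq_lintegral_le hm.restrict
    _ ≤ _ := by
      rw [Measure.restrict_apply_univ]
      gcongr
      exact Measure.restrict_le_self

theorem measurable_enorm_fourier_sq {v : WithLp 2 (E × F) → ℂ} (h1 : Integrable v) :
    Measurable fun ζ => ‖𝓕 v ζ‖ₑ ^ 2 :=
  (continuous_fourier_of_integrable h1).measurable.enorm.pow_const 2

/-- The horizontal part of the energy, written with iterated integrals. -/
theorem lintegral_fst_weight_fourier (s : ℝ) {v : WithLp 2 (E × F) → ℂ} (h1 : Integrable v) :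
    ∫⁻ ζ : WithLp 2 (E × F), ENNReal.ofReal ((2 * Real.pi * ‖ζ.fst‖) ^ (2 * s)) * ‖𝓕 v ζ‖ₑ ^ 2 =
      ∫⁻ ξ : E, ENNReal.ofReal ((2 * Real.pi * ‖ξ‖) ^ (2 * s)) *
        ∫⁻ η : F, ‖𝓕 v (WithLp.toLp 2 (ξ, η))‖ₑ ^ 2 := by
  have hm := measurable_enorm_fourier_sq h1
  have hw : Measurable fun ζ : WithLp 2 (E × F) => (2 * Real.pi * ‖ζ.fst‖) ^ (2 * s) := by
    have : Continuous fun ζ : WithLp 2 (E × F) => ζ.fst := by fun_prop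
    fun_prop
  refine (lintegral_withLp_prod (hw.ennreal_ofReal.mul hm).aemeasurable).trans ?_
  congr 1 with ξ
  rw [← lintegral_const_mul' _ _ (by simp)]
  rfl

/-- Fractional Poincaré inequality in the first variable. -/
theorem exists_poincare_fst [Nontrivial E] {s : ℝ} (hs : 0 < s) {A : Set E}
    (hA : MeasurableSet A) (hAf : volume A ≠ ⊤) :
    ∃ C : ℝ≥0∞, C ≠ ⊤ ∧ ∀ v : WithLp 2 (E × F) → ℂ, Integrable v → MemLp v 2 volume →
      (∀ᵐ z : WithLp 2 (E × F), z.fst ∉ A → v z = 0) →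
      ∫⁻ z, ‖v z‖ₑ ^ 2 ≤ C * ∫⁻ ζ : WithLp 2 (E × F),
        ENNReal.ofReal ((2 * Real.pi * ‖ζ.fst‖) ^ (2 * s)) * ‖𝓕 v ζ‖ₑ ^ 2 := by
  -- The radius is small enough that the frequencies `|ξ| < r` carry at most half of the mass.
  -- Nontriviality of `E` makes the volume of the ball tend to zero with `r`.
  obtain ⟨r, hr, hrA⟩ : ∃ r : ℝ, 0 < r ∧ volume (Metric.ball (0 : E) r) * volume A ≤ 2⁻¹ := by
    have h1 : Tendsto (fun r : ℝ => ENNReal.ofReal (r ^ Module.finrank ℝ E) *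
        (volume (Metric.ball (0 : E) 1) * volume A)) (𝓝[>] 0) (𝓝 0) := by
      have h2 : Tendsto (fun r : ℝ => ENNReal.ofReal (r ^ Module.finrank ℝ E)) (𝓝[>] 0) (𝓝 0) := by
        have : Tendsto (fun r : ℝ => ENNReal.ofReal (r ^ Module.finrank ℝ E)) (𝓝 0)
            (𝓝 (ENNReal.ofReal (0 ^ Module.finrank ℝ E))) :=
          (ENNReal.continuous_ofReal.comp (continuous_pow _)).tendsto 0
        rw [zero_pow Module.finrank_pos.ne', ENNReal.ofReal_zero] at this
        exact this.mono_left nhdsWithin_le_nhds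
      have := ENNReal.Tendsto.mul_const (b := volume (Metric.ball (0 : E) 1) * volume A) h2
        (Or.inr (ENNReal.mul_ne_top measure_ball_lt_top.ne hAf))
      rwa [zero_mul] at this
    obtain ⟨r, h, hr⟩ := ((h1.eventually_lt_const (u := 2⁻¹) (by simp)).and
      self_mem_nhdsWithin).exists
    refine ⟨r, hr, ?_⟩
    rw [Measure.addHaar_ball _ _ (le_of_lt hr), mul_assoc]
    exact h.le
  set c : ℝ := (2 * Real.pi * r) ^ (2 * s) with hc
  have hcpos : 0 < c := by positivity
  refine ⟨2 * ENNReal.ofReal c⁻¹, by finiteness, fun v h1 h2 h0 => ?_⟩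
  set D := ∫⁻ ζ : WithLp 2 (E × F),
        ENNReal.ofReal ((2 * Real.pi * ‖ζ.fst‖) ^ (2 * s)) * ‖𝓕 v ζ‖ₑ ^ 2 with hD
  set N := ∫⁻ z, ‖v z‖ₑ ^ 2 with hN
  have hNf : N ≠ ⊤ := (lintegral_enorm_sq_lt_top h2).ne
  -- Low frequencies are controlled by the slice bound `|A| N`, uniform in `ξ`; for `|ξ| ≥ r` the
  -- weight is at least `c`.
  have key : N ≤ 2⁻¹ * N + ENNReal.ofReal c⁻¹ * D := by
    have hm := measurable_enorm_fourier_sq h1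
    calc N = ∫⁻ ξ : E, ∫⁻ η : F, ‖𝓕 v (WithLp.toLp 2 (ξ, η))‖ₑ ^ 2 := by
          rw [hN, ← lintegral_enorm_sq_fourier h1 h2, lintegral_withLp_prod hm.aemeasurable]
      _ ≤ ∫⁻ ξ : E, ((Metric.ball (0 : E) r).indicator (fun _ => volume A * N) ξ
          + ENNReal.ofReal c⁻¹ * (ENNReal.ofReal ((2 * Real.pi * ‖ξ‖) ^ (2 * s)) *
            ∫⁻ η : F, ‖𝓕 v (WithLp.toLp 2 (ξ, η))‖ₑ ^ 2)) := by
          apply lintegral_mono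
          intro ξ
          by_cases hξ : ξ ∈ Metric.ball (0 : E) r
          · simp only [Set.indicator_of_mem hξ]
            exact (lintegral_enorm_fourier_sq_slice_le h1 h2 hA hAf h0 ξ).trans le_self_add
          · refine le_trans ?_ le_add_self
            rw [← mul_assoc, ← ENNReal.ofReal_mul (by positivity)]
            apply le_mul_of_one_le_left zero_le
            rw [ENNReal.one_le_ofReal, ← div_eq_inv_mul, one_le_div hcpos]
            rw [mem_ball_zero_iff, not_lt] at hξ
            exact Real.rpow_le_rpow (by positivity) (by gcongr) (by positivity)
      _ = volume (Metric.ball (0 : E) r) * volume A * N + ENNReal.ofReal c⁻¹ * D := by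
          rw [lintegral_add_left (measurable_const.indicator measurableSet_ball),
            lintegral_indicator measurableSet_ball, setLIntegral_const,
            lintegral_const_mul' _ _ (by simp), hD, lintegral_fst_weight_fourier s h1]
          ring
      _ ≤ _ := by gcongr
  have h3 : N = 2⁻¹ * N + 2⁻¹ * N := by
    rw [← add_mul, ENNReal.inv_two_add_inv_two, one_mul]
  have h4 : 2⁻¹ * N ≤ ENNReal.ofReal c⁻¹ * D := by
    have : 2⁻¹ * N + 2⁻¹ * N ≤ 2⁻¹ * N + ENNReal.ofReal c⁻¹ * D := by rwa [← h3]
    -- Absorbing half of `N` on the left is legitimate because `N` is finite.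
    exact (ENNReal.add_le_add_iff_left (by finiteness)).1 this
  calc N = 2 * (2⁻¹ * N) := by
        rw [← mul_assoc, ENNReal.mul_inv_cancel (by simp) (by simp), one_mul]
    _ ≤ 2 * (ENNReal.ofReal c⁻¹ * D) := by gcongr
    _ = _ := by ring

end Slicing

/-! ### Dilation of the second variable and its effect on the symbol -/

section DilationNorms

/-- The dilation `(x, t) ↦ (x, r t)` of the second variable. -/
def dilateSnd {E F : Type*} [SMul ℝ F] (r : ℝ) (z : WithLp 2 (E × F)) : WithLp 2 (E × F) :=
  WithLp.toLp 2 (z.fst, r • z.snd)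

theorem dilateSnd_dilateSnd_inv {E F : Type*} [AddCommGroup F] [Module ℝ F] {r : ℝ} (hr : r ≠ 0)
    (z : WithLp 2 (E × F)) : dilateSnd r (dilateSnd r⁻¹ z) = z := by
  simp [dilateSnd, smul_smul, hr]
  rfl

theorem dilateSnd_inv_dilateSnd {E F : Type*} [AddCommGroup F] [Module ℝ F] {r : ℝ} (hr : r ≠ 0)
    (z : WithLp 2 (E × F)) : dilateSnd r⁻¹ (dilateSnd r z) = z := by
  simp [dilateSnd, smul_smul, hr]
  rfl

theorem continuous_dilateSnd {E F : Type*} [TopologicalSpace E] [TopologicalSpace F] [SMul ℝ F]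
    [ContinuousConstSMul ℝ F] (r : ℝ) :
    Continuous (dilateSnd r : WithLp 2 (E × F) → WithLp 2 (E × F)) := by
  unfold dilateSnd
  fun_prop

theorem measurableEmbedding_dilateSnd {E F : Type*} [NormedAddCommGroup E] [MeasurableSpace E]
    [BorelSpace E] [NormedAddCommGroup F] [InnerProductSpace ℝ F] [FiniteDimensional ℝ F]
    [MeasurableSpace F] [BorelSpace F] {r : ℝ} (hr : r ≠ 0) :
    MeasurableEmbedding (dilateSnd r : WithLp 2 (E × F) → WithLp 2 (E × F)) :=
  (Homeomorph.mk ⟨dilateSnd r, dilateSnd r⁻¹, dilateSnd_inv_dilateSnd hr,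
    dilateSnd_dilateSnd_inv hr⟩ (continuous_dilateSnd r)
    (continuous_dilateSnd r⁻¹)).measurableEmbedding

variable {E F : Type*} [NormedAddCommGroup E] [NormedAddCommGroup F]

theorem norm_sq_toLp_prod (x : E) (t : F) :
    ‖(WithLp.toLp 2 (x, t) : WithLp 2 (E × F))‖ ^ 2 = ‖x‖ ^ 2 + ‖t‖ ^ 2 := by
  exact WithLp.prod_norm_sq_eq_of_L2 _

variable [NormedSpace ℝ F]

theorem norm_fst_le_norm_dilateSnd (r : ℝ) (z : WithLp 2 (E × F)) :
    ‖z.fst‖ ≤ ‖dilateSnd r z‖ := by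
  apply le_of_sq_le_sq _ (norm_nonneg _)
  rw [dilateSnd, norm_sq_toLp_prod]
  exact le_add_of_nonneg_right (sq_nonneg _)

theorem norm_dilateSnd_le (r : ℝ) (z : WithLp 2 (E × F)) :
    ‖dilateSnd r z‖ ≤ max 1 |r| * ‖z‖ := by
  apply le_of_sq_le_sq _ (by positivity)
  rw [dilateSnd, norm_sq_toLp_prod, mul_pow, WithLp.prod_norm_sq_eq_of_L2, norm_smul, mul_add,
    mul_pow, Real.norm_eq_abs]
  have h1 : 1 ≤ max 1 |r| ^ 2 := one_le_pow₀ (le_max_left _ _)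
  have h2 : |r| ^ 2 ≤ max 1 |r| ^ 2 := by gcongr; exact le_max_right _ _
  gcongr
  exact le_mul_of_one_le_left (sq_nonneg _) h1

/-- The left side is the `s`-th power of a sum of two squares, and `τ ↦ τ^s` is subadditive for `0 ≤
s ≤ 1`. -/
theorem rpow_norm_dilateSnd_le {s : ℝ} (hs0 : 0 ≤ s) (hs1 : s ≤ 1) {r : ℝ} (hr : 0 < r)
    (ζ : WithLp 2 (E × F)) :
    (2 * Real.pi * ‖dilateSnd r⁻¹ ζ‖) ^ (2 * s) ≤
      (2 * Real.pi * ‖ζ.fst‖) ^ (2 * s) + r⁻¹ ^ (2 * s) * (2 * Real.pi * ‖ζ.snd‖) ^ (2 * s) := by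
  have e : ∀ a : ℝ, 0 ≤ a → a ^ (2 * s) = (a ^ 2) ^ s := fun a ha => by
    rw [Real.rpow_mul ha]; norm_cast
  rw [← Real.mul_rpow (by positivity) (by positivity), e _ (by positivity), e _ (by positivity),
    e _ (by positivity)]
  refine le_trans (le_of_eq ?_) (Real.rpow_add_le_add_rpow (by positivity) (by positivity) hs0 hs1)
  congr 1
  rw [mul_pow, dilateSnd, norm_sq_toLp_prod, norm_smul, Real.norm_of_nonneg (by positivity)]
  ring

end DilationNorms

/-! ### Energies of stretched functions and of integrals in the second variable -/

section Dilation

variable {E F : Type*} [NormedAddCommGroup E] [InnerProductSpace ℝ E] [FiniteDimensional ℝ E]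
  [MeasurableSpace E] [BorelSpace E] [NormedAddCommGroup F] [InnerProductSpace ℝ F]
  [FiniteDimensional ℝ F] [MeasurableSpace F] [BorelSpace F]

theorem map_dilateSnd_volume {r : ℝ} (hr : 0 < r) :
    Measure.map (dilateSnd r) (volume : Measure (WithLp 2 (E × F))) =
      ENNReal.ofReal (r ^ Module.finrank ℝ F)⁻¹ • volume := by
  have hT := (WithLp.volume_preserving_toLp E F)
  have h1 : Measure.map (Prod.map id (fun t : F => r • t)) ((volume : Measure E).prod volume) =
      ENNReal.ofReal (r ^ Module.finrank ℝ F)⁻¹ • (volume : Measure E).prod volume := by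
    rw [← Measure.map_prod_map _ _ measurable_id (measurable_const_smul r), Measure.map_id,
      Measure.map_addHaar_smul _ hr.ne', Measure.prod_smul_right, abs_of_pos (by positivity)]
  rw [← hT.map_eq, ← Measure.map_smul, Measure.volume_eq_prod, ← h1,
    Measure.map_map (continuous_dilateSnd r).measurable hT.measurable,
    Measure.map_map hT.measurable (by fun_prop)]
  rfl

theorem lintegral_comp_dilateSnd {r : ℝ} (hr : 0 < r) (f : WithLp 2 (E × F) → ℝ≥0∞) :
    ∫⁻ z, f (dilateSnd r z) = ENNReal.ofReal (r ^ Module.finrank ℝ F)⁻¹ * ∫⁻ z, f z := by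
  rw [← (measurableEmbedding_dilateSnd hr.ne').lintegral_map, map_dilateSnd_volume hr,
    lintegral_smul_measure, smul_eq_mul]

theorem integral_comp_dilateSnd {G : Type*} [NormedAddCommGroup G] [NormedSpace ℝ G] {r : ℝ}
    (hr : 0 < r) (f : WithLp 2 (E × F) → G) :
    ∫ z, f (dilateSnd r z) = (r ^ Module.finrank ℝ F)⁻¹ • ∫ z, f z := by
  rw [← (measurableEmbedding_dilateSnd hr.ne').integral_map, map_dilateSnd_volume hr,
    integral_smul_measure, ENNReal.toReal_ofReal (by positivity)]

theorem setIntegral_comp_dilateSnd {r : ℝ} (hr : 0 < r) (f : WithLp 2 (E × F) → ℝ)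
    (S : Set (WithLp 2 (E × F))) :
    ∫ z in dilateSnd r ⁻¹' S, f (dilateSnd r z) =
      (r ^ Module.finrank ℝ F)⁻¹ * ∫ z in S, f z := by
  rw [← (measurableEmbedding_dilateSnd hr.ne').setIntegral_map, map_dilateSnd_volume hr,
    Measure.restrict_smul, integral_smul_measure, ENNReal.toReal_ofReal (by positivity),
    smul_eq_mul]

theorem memLp_comp_dilateSnd {G : Type*} [NormedAddCommGroup G] {p : ℝ≥0∞} {r : ℝ} (hr : 0 < r)
    {f : WithLp 2 (E × F) → G} {S : Set (WithLp 2 (E × F))} (hf : MemLp f p (volume.restrict S)) :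
    MemLp (fun z => f (dilateSnd r z)) p (volume.restrict (dilateSnd r ⁻¹' S)) := by
  have he := measurableEmbedding_dilateSnd (E := E) (F := F) hr.ne'
  have := he.memLp_map_measure_iff (μ := volume.restrict (dilateSnd r ⁻¹' S)) (p := p) (g := f)
  refine this.1 ?_
  rw [← he.restrict_map, map_dilateSnd_volume hr, Measure.restrict_smul]
  exact hf.smul_measure ENNReal.ofReal_ne_top

theorem integrable_comp_dilateSnd {G : Type*} [NormedAddCommGroup G] {r : ℝ} (hr : 0 < r)
    {f : WithLp 2 (E × F) → G} (hf : Integrable f) :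
    Integrable (fun z => f (dilateSnd r z)) := by
  rw [← memLp_one_iff_integrable, ← Measure.restrict_univ (μ := volume)] at *
  exact memLp_comp_dilateSnd hr hf

/-- The dilation is self-adjoint for the inner product, so it reappears on the frequency variable,
with its Jacobian as a factor. -/
theorem fourier_comp_dilateSnd_inv {r : ℝ} (hr : 0 < r) (v : WithLp 2 (E × F) → ℂ)
    (ζ : WithLp 2 (E × F)) :
    𝓕 (fun z => v (dilateSnd r⁻¹ z)) ζ = (r ^ Module.finrank ℝ F) • 𝓕 v (dilateSnd r ζ) := by
  have h := integral_comp_dilateSnd hr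
    (fun z => Real.fourierChar (-inner ℝ z ζ) • v (dilateSnd r⁻¹ z))
  rw [Real.fourier_eq, Real.fourier_eq]
  have e : ∀ z : WithLp 2 (E × F), inner ℝ (dilateSnd r z) ζ = inner ℝ z (dilateSnd r ζ) := by
    intro z
    rw [WithLp.prod_inner_apply, WithLp.prod_inner_apply]
    simp [dilateSnd, inner_smul_left, inner_smul_right]
  simp only [dilateSnd_inv_dilateSnd hr.ne', e] at h
  rw [h, smul_smul, mul_inv_cancel₀ (by positivity), one_smul]

/-- The energy of a stretched function, normalised by the volume factor and written in terms
of the Fourier transform of the function itself. -/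
noncomputable def anisoEnergy (s r : ℝ) (u : WithLp 2 (E × F) → ℝ) : ℝ≥0∞ :=
  ∫⁻ ζ : WithLp 2 (E × F), ENNReal.ofReal ((2 * Real.pi * ‖dilateSnd r⁻¹ ζ‖) ^ (2 * s)) *
    ‖𝓕 (fun z => (u z : ℂ)) ζ‖ₑ ^ 2

/-- The part of the energy that only involves the first frequency variable. -/
noncomputable def fstEnergy (s : ℝ) (u : WithLp 2 (E × F) → ℝ) : ℝ≥0∞ :=
  ∫⁻ ζ : WithLp 2 (E × F), ENNReal.ofReal ((2 * Real.pi * ‖ζ.fst‖) ^ (2 * s)) *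
    ‖𝓕 (fun z => (u z : ℂ)) ζ‖ₑ ^ 2

/-- With `d` the dimension of `F`, the squared transform contributes `r^(2d)` and the change of
frequency variable `r^(-d)`. The remaining `r^d` is the volume ratio that the normalisation by
`|ℓB|` removes. -/
theorem fracEnergyE_comp_dilateSnd_inv (s : ℝ) {r : ℝ} (hr : 0 < r) {u : WithLp 2 (E × F) → ℝ}
    (h1 : Integrable u) (h2 : MemLp u 2 (volume : Measure (WithLp 2 (E × F)))) :
    fracEnergyE s (fun z => u (dilateSnd r⁻¹ z)) =
      ENNReal.ofReal (r ^ Module.finrank ℝ F) * anisoEnergy s r u := by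
  have h2' : MemLp (fun z => u (dilateSnd r⁻¹ z)) 2 (volume : Measure (WithLp 2 (E × F))) := by
    rw [← Measure.restrict_univ (μ := volume)] at h2 ⊢
    exact memLp_comp_dilateSnd (inv_pos.2 hr) h2
  rw [fracEnergyE_eq_lintegral_fourier s (integrable_comp_dilateSnd (inv_pos.2 hr) h1) h2']
  have e : ∀ ζ : WithLp 2 (E × F), ‖𝓕 (fun z => ((u (dilateSnd r⁻¹ z) : ℝ) : ℂ)) ζ‖ₑ ^ 2 =
      ENNReal.ofReal (r ^ Module.finrank ℝ F) ^ 2 *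
        ‖𝓕 (fun z => (u z : ℂ)) (dilateSnd r ζ)‖ₑ ^ 2 := fun ζ => by
    rw [fourier_comp_dilateSnd_inv hr (fun z => (u z : ℂ)), enorm_smul, mul_pow,
      Real.enorm_eq_ofReal (by positivity)]
  have h := lintegral_comp_dilateSnd hr (fun ζ : WithLp 2 (E × F) =>
    ENNReal.ofReal ((2 * Real.pi * ‖dilateSnd r⁻¹ ζ‖) ^ (2 * s)) *
      ‖𝓕 (fun z => (u z : ℂ)) ζ‖ₑ ^ 2)
  simp only [dilateSnd_inv_dilateSnd hr.ne'] at h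
  simp_rw [e, mul_left_comm _ (ENNReal.ofReal (r ^ Module.finrank ℝ F) ^ 2)]
  rw [lintegral_const_mul' _ _ (by finiteness), h, anisoEnergy, ← mul_assoc, sq, mul_assoc,
    mul_assoc, ← mul_assoc (ENNReal.ofReal _) (ENNReal.ofReal (r ^ _)⁻¹),
    ← ENNReal.ofReal_mul (by positivity), mul_inv_cancel₀ (by positivity), ENNReal.ofReal_one,
    one_mul]

theorem fstEnergy_le_anisoEnergy {s : ℝ} (hs : 0 ≤ s) (r : ℝ) (u : WithLp 2 (E × F) → ℝ) :
    fstEnergy s u ≤ anisoEnergy s r u := by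
  apply lintegral_mono
  intro ζ
  dsimp only
  gcongr
  exact norm_fst_le_norm_dilateSnd _ _

/-- The dilation distorts norms by at most `max 1 |r⁻¹|`. Finiteness is what makes the later
passages to `toReal` lossless. -/
theorem anisoEnergy_lt_top {s : ℝ} (hs : 0 ≤ s) (r : ℝ) {u : WithLp 2 (E × F) → ℝ}
    (h1 : Integrable u) (h2 : MemLp u 2 (volume : Measure (WithLp 2 (E × F))))
    (hu : fracEnergyE s u < ⊤) : anisoEnergy s r u < ⊤ := by
  rw [fracEnergyE_eq_lintegral_fourier s h1 h2] at hu
  refine lt_of_le_of_lt ?_ (ENNReal.mul_lt_top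
    (ENNReal.ofReal_lt_top (r := max 1 |r⁻¹| ^ (2 * s))) hu)
  rw [← lintegral_const_mul' _ _ (by simp)]
  apply lintegral_mono
  intro ζ
  dsimp only
  rw [← mul_assoc, ← ENNReal.ofReal_mul (by positivity),
    ← Real.mul_rpow (by positivity) (by positivity)]
  refine mul_le_mul_left (ENNReal.ofReal_le_ofReal
    (Real.rpow_le_rpow (by positivity) ?_ (by positivity))) _
  calc 2 * Real.pi * ‖dilateSnd r⁻¹ ζ‖ ≤ 2 * Real.pi * (max 1 |r⁻¹| * ‖ζ‖) := by
        gcongr; exact norm_dilateSnd_le _ _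
    _ = _ := by ring

theorem memLp_integral_snd {v : WithLp 2 (E × F) → ℝ} {C : Set F} (hC : volume C ≠ ⊤)
    (h2 : MemLp v 2 (volume : Measure (WithLp 2 (E × F)))) :
    MemLp (fun x : E => ∫ t in C, v (WithLp.toLp 2 (x, t))) 2 volume := by
  have hle : (volume : Measure E).prod (volume.restrict C) ≤
      (volume : Measure E).prod (volume : Measure F) := by
    rw [← Measure.restrict_univ (μ := (volume : Measure E)), Measure.prod_restrict,
      Measure.restrict_univ]
    exact Measure.restrict_le_self
  have hm : AEStronglyMeasurable (fun p : E × F => v (WithLp.toLp 2 p))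
      ((volume : Measure E).prod (volume.restrict C)) :=
    (aestronglyMeasurable_comp_toLp_prod h2.1).mono_measure hle
  refine memLp_two_of_lintegral_lt_top hm.integral_prod_right' ?_
  have hm2 : AEMeasurable (fun z : WithLp 2 (E × F) => ‖v z‖ₑ ^ 2) := h2.1.enorm.pow_const 2
  calc ∫⁻ x : E, ‖∫ t in C, v (WithLp.toLp 2 (x, t))‖ₑ ^ 2
      ≤ ∫⁻ x : E, volume C * ∫⁻ t : F, ‖v (WithLp.toLp 2 (x, t))‖ₑ ^ 2 := by
        apply lintegral_mono_ae
        filter_upwards [(aestronglyMeasurable_comp_toLp_prod h2.1).prodMk_left] with x hx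
        calc _ ≤ (∫⁻ t in C, ‖v (WithLp.toLp 2 (x, t))‖ₑ) ^ 2 := by
              gcongr; exact enorm_integral_le_lintegral_enorm _
          _ ≤ _ := sq_lintegral_le hx.enorm.restrict
          _ ≤ _ := by
            rw [Measure.restrict_apply_univ]
            gcongr
            exact Measure.restrict_le_self
    _ = volume C * ∫⁻ z, ‖v z‖ₑ ^ 2 := by
        rw [lintegral_const_mul' _ _ hC, lintegral_withLp_prod hm2]
    _ < ⊤ := ENNReal.mul_lt_top hC.lt_top (lintegral_enorm_sq_lt_top h2)

theorem integral_snd_ae_zero {v : WithLp 2 (E × F) → ℝ} {A : Set E}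
    (h0 : ∀ᵐ z : WithLp 2 (E × F), z.fst ∉ A → v z = 0) (C : Set F) :
    ∀ᵐ x : E, x ∉ A → ∫ t in C, v (WithLp.toLp 2 (x, t)) = 0 := by
  filter_upwards [Measure.ae_ae_of_ae_prod (ae_toLp_prod h0)] with x hx hxA
  apply integral_eq_zero_of_ae
  filter_upwards [ae_restrict_of_ae hx] with t ht using ht hxA

/-- Integration in the second variable decreases the energy (Jensen's inequality). -/
theorem fracEnergyE_integral_snd_le (s : ℝ) {v : WithLp 2 (E × F) → ℝ} (h1 : Integrable v)
    (h2 : MemLp v 2 (volume : Measure (WithLp 2 (E × F)))) {A : Set E} (hA : MeasurableSet A)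
    (hAf : volume A ≠ ⊤) (h0 : ∀ᵐ z : WithLp 2 (E × F), z.fst ∉ A → v z = 0) {C : Set F}
    (hC : volume C ≠ ⊤) :
    fracEnergyE s (fun x : E => ∫ t in C, v (WithLp.toLp 2 (x, t))) ≤
      volume C * fstEnergy s v := by
  have hw := memLp_integral_snd hC h2
  rw [fracEnergyE_eq_lintegral_fourier s
    (integrable_of_ae_zero hw hA hAf (integral_snd_ae_zero h0 C)) hw, fstEnergy,
    lintegral_fst_weight_fourier s (v := fun z => (v z : ℂ)) h1.ofReal, ← lintegral_const_mul' _ _ hC]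
  apply lintegral_mono
  intro ξ
  dsimp only
  rw [mul_left_comm]
  gcongr
  -- The inequality holds frequency by frequency, so any weight depending on `ξ` alone can be
  -- carried along.
  have h := enorm_fourier_setIntegral_sq_le (v := fun z => (v z : ℂ)) h1.ofReal h2.ofReal hA hAf
    (h0.mono fun z hz hzA => by simp [hz hzA]) C ξ
  have e : (fun x : E => ∫ t in C, ((v (WithLp.toLp 2 (x, t)) : ℝ) : ℂ)) =
      fun x => ((∫ t in C, v (WithLp.toLp 2 (x, t)) : ℝ) : ℂ) := funext fun x => integral_ofReal
  rwa [e] at h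

end Dilation

/-! ### Tensor products `u(x) φ(t)` -/

section TensorProducts

variable {E F : Type*} [NormedAddCommGroup E] [InnerProductSpace ℝ E] [FiniteDimensional ℝ E]
  [MeasurableSpace E] [BorelSpace E] [NormedAddCommGroup F] [InnerProductSpace ℝ F]
  [FiniteDimensional ℝ F] [MeasurableSpace F] [BorelSpace F]

theorem integrable_tensor {u : E → ℝ} {φ : F → ℝ} (hu : Integrable u) (hφ : Integrable φ) :
    Integrable fun z : WithLp 2 (E × F) => u z.fst * φ z.snd :=
  ((WithLp.volume_preserving_toLp E F).integrable_comp_emb measurableEmbedding_toLp_prod).1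
    (hu.mul_prod hφ)

theorem aestronglyMeasurable_tensor {u : E → ℝ} {φ : F → ℝ} (hu : AEStronglyMeasurable u volume)
    (hφ : AEStronglyMeasurable φ volume) :
    AEStronglyMeasurable (fun z : WithLp 2 (E × F) => u z.fst * φ z.snd) volume := by
  have h : AEStronglyMeasurable (fun p : E × F => u p.1 * φ p.2) volume :=
    hu.comp_fst.mul hφ.comp_snd
  exact h.comp_quasiMeasurePreserving (WithLp.volume_preserving_ofLp E F).quasiMeasurePreserving

theorem lintegral_tensor {f : E → ℝ≥0∞} {g : F → ℝ≥0∞} (hf : AEMeasurable f)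
    (hg : AEMeasurable g) :
    ∫⁻ z : WithLp 2 (E × F), f z.fst * g z.snd = (∫⁻ x, f x) * ∫⁻ t, g t := by
  rw [lintegral_withLp_prod', ← lintegral_prod_mul hf hg]
  rfl

theorem lintegral_enorm_sq_tensor {u : E → ℝ} {φ : F → ℝ} (hu : AEStronglyMeasurable u volume)
    (hφ : AEStronglyMeasurable φ volume) :
    ∫⁻ z : WithLp 2 (E × F), ‖u z.fst * φ z.snd‖ₑ ^ 2 =
      (∫⁻ x, ‖u x‖ₑ ^ 2) * ∫⁻ t, ‖φ t‖ₑ ^ 2 := by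
  simp_rw [enorm_mul, mul_pow]
  exact lintegral_tensor (hu.enorm.pow_const 2) (hφ.enorm.pow_const 2)

theorem memLp_tensor {u : E → ℝ} {φ : F → ℝ} (hu : MemLp u 2 (volume : Measure E))
    (hφ : MemLp φ 2 (volume : Measure F)) :
    MemLp (fun z : WithLp 2 (E × F) => u z.fst * φ z.snd) 2 volume := by
  refine memLp_two_of_lintegral_lt_top (aestronglyMeasurable_tensor hu.1 hφ.1) ?_
  rw [lintegral_enorm_sq_tensor hu.1 hφ.1]
  exact ENNReal.mul_lt_top (lintegral_enorm_sq_lt_top hu) (lintegral_enorm_sq_lt_top hφ)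

theorem fourier_tensor {u : E → ℝ} {φ : F → ℝ} (hu : Integrable u) (hφ : Integrable φ)
    (ζ : WithLp 2 (E × F)) :
    𝓕 (fun z : WithLp 2 (E × F) => ((u z.fst * φ z.snd : ℝ) : ℂ)) ζ =
      𝓕 (fun x => (u x : ℂ)) ζ.fst * 𝓕 (fun t => (φ t : ℂ)) ζ.snd := by
  have h := fourier_partialFourier (integrable_tensor hu hφ).ofReal ζ.fst ζ.snd
  refine h.symm.trans ?_
  have e : partialFourier (fun z : WithLp 2 (E × F) => ((u z.fst * φ z.snd : ℝ) : ℂ)) ζ.fst =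
      fun t => 𝓕 (fun x => (u x : ℂ)) ζ.fst * (φ t : ℂ) := by
    funext t
    rw [partialFourier_eq, Real.fourier_eq, ← integral_mul_const]
    congr 1 with x
    simp [Circle.smul_def, mul_assoc]
  change 𝓕 (partialFourier (fun z : WithLp 2 (E × F) => ((u z.fst * φ z.snd : ℝ) : ℂ)) ζ.fst)
    ζ.snd = _
  rw [e, Real.fourier_eq, Real.fourier_eq (fun t => (φ t : ℂ)), ← integral_const_mul]
  congr 1 with t
  simp only [Circle.smul_def, smul_eq_mul]
  ring

/-- The transform of a tensor product factorises and the symbol is bounded by a sum of one-variable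
symbols, so each term is a product of integrals; Plancherel identifies the unweighted factors. -/
theorem anisoEnergy_tensor_le {s : ℝ} (hs0 : 0 ≤ s) (hs1 : s ≤ 1) {r : ℝ} (hr : 0 < r)
    {u : E → ℝ} {φ : F → ℝ} (hu1 : Integrable u) (hu2 : MemLp u 2 (volume : Measure E))
    (hφ1 : Integrable φ) (hφ2 : MemLp φ 2 (volume : Measure F)) :
    anisoEnergy s r (fun z : WithLp 2 (E × F) => u z.fst * φ z.snd) ≤
      fracEnergyE s u * (∫⁻ t, ‖φ t‖ₑ ^ 2) +
        ENNReal.ofReal (r⁻¹ ^ (2 * s)) * ((∫⁻ x, ‖u x‖ₑ ^ 2) * fracEnergyE s φ) := by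
  have hmu : Measurable fun ξ : E => ‖𝓕 (fun x => (u x : ℂ)) ξ‖ₑ ^ 2 :=
    (continuous_fourier_of_integrable hu1.ofReal).measurable.enorm.pow_const 2
  have hmφ : Measurable fun η : F => ‖𝓕 (fun t => (φ t : ℂ)) η‖ₑ ^ 2 :=
    (continuous_fourier_of_integrable hφ1.ofReal).measurable.enorm.pow_const 2
  have hwE : Measurable fun ξ : E => ENNReal.ofReal ((2 * Real.pi * ‖ξ‖) ^ (2 * s)) := by fun_prop
  have hwF : Measurable fun ξ : F => ENNReal.ofReal ((2 * Real.pi * ‖ξ‖) ^ (2 * s)) := by fun_prop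
  have p1 : ∫⁻ x, ‖u x‖ₑ ^ 2 = ∫⁻ ξ : E, ‖𝓕 (fun x => (u x : ℂ)) ξ‖ₑ ^ 2 := by
    refine Eq.trans ?_ (lintegral_enorm_sq_fourier hu1.ofReal hu2.ofReal).symm
    simp [enorm_eq_nnnorm]
  have p2 : ∫⁻ t, ‖φ t‖ₑ ^ 2 = ∫⁻ η : F, ‖𝓕 (fun t => (φ t : ℂ)) η‖ₑ ^ 2 := by
    refine Eq.trans ?_ (lintegral_enorm_sq_fourier hφ1.ofReal hφ2.ofReal).symm
    simp [enorm_eq_nnnorm]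
  have q1 := lintegral_tensor (hwE.mul hmu).aemeasurable hmφ.aemeasurable
  have q2 := lintegral_tensor hmu.aemeasurable (hwF.mul hmφ).aemeasurable
  have hmfst : Measurable fun z : WithLp 2 (E × F) => z.fst :=
    (by fun_prop : Continuous fun z : WithLp 2 (E × F) => z.fst).measurable
  have hmsnd : Measurable fun z : WithLp 2 (E × F) => z.snd :=
    (by fun_prop : Continuous fun z : WithLp 2 (E × F) => z.snd).measurable
  simp only [Pi.mul_apply] at q1 q2
  rw [fracEnergyE_eq_lintegral_fourier s hu1 hu2, fracEnergyE_eq_lintegral_fourier s hφ1 hφ2,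
    p1, p2, ← q1, ← q2, ← lintegral_const_mul' _ _ (by simp), anisoEnergy]
  refine le_trans ?_ (lintegral_add_left (((hwE.mul hmu).comp hmfst).mul (hmφ.comp hmsnd)) _).le
  apply lintegral_mono
  intro ζ
  simp only [Pi.mul_apply, Function.comp_apply]
  rw [fourier_tensor hu1 hφ1, enorm_mul, mul_pow]
  calc _ ≤ (ENNReal.ofReal ((2 * Real.pi * ‖ζ.fst‖) ^ (2 * s)) + ENNReal.ofReal (r⁻¹ ^ (2 * s)) *
        ENNReal.ofReal ((2 * Real.pi * ‖ζ.snd‖) ^ (2 * s))) *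
        (‖𝓕 (fun x => (u x : ℂ)) ζ.fst‖ₑ ^ 2 * ‖𝓕 (fun t => (φ t : ℂ)) ζ.snd‖ₑ ^ 2) := by
        gcongr
        rw [← ENNReal.ofReal_mul (by positivity), ← ENNReal.ofReal_add (by positivity)
          (by positivity)]
        exact ENNReal.ofReal_le_ofReal (rpow_norm_dilateSnd_le hs0 hs1 hr ζ)
    _ = _ := by ring

end TensorProducts

/-! ### Smooth cut-off functions -/

section TestFunctions

variable {V : Type*} [NormedAddCommGroup V] [InnerProductSpace ℝ V] [FiniteDimensional ℝ V]
  [MeasurableSpace V] [BorelSpace V]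

theorem fracEnergyE_lt_top_of_contDiff {s : ℝ} (hs0 : 0 ≤ s) (hs1 : s ≤ 1) {φ : V → ℝ}
    (hφ : ContDiff ℝ (⊤ : ℕ∞) φ) (hc : HasCompactSupport φ) : fracEnergyE s φ < ⊤ := by
  have hc' : HasCompactSupport fun x => (φ x : ℂ) := hc.comp_left (g := fun r : ℝ => (r : ℂ)) rfl
  set G : SchwartzMap V ℂ := hc'.toSchwartzMap (Complex.ofRealCLM.contDiff.comp hφ) with hG
  have e : 𝓕 (fun x => (φ x : ℂ)) = (𝓕 G : SchwartzMap V ℂ) := (SchwartzMap.fourier_coe G).symm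
  rw [fracEnergyE_eq_lintegral_fourier s (hφ.continuous.integrable_of_hasCompactSupport hc)
    (hφ.continuous.memLp_of_hasCompactSupport hc), e]
  set g : SchwartzMap V ℂ := 𝓕 G
  -- The sup bound replaces one of the two factors of `‖g‖ ^ 2`, so integrability of `‖ξ‖ ^ 2 * ‖g
  -- ξ‖` suffices.
  obtain ⟨C, hC⟩ := g.decay 0 0
  simp only [pow_zero, one_mul, norm_iteratedFDeriv_zero] at hC
  have h1 : Integrable fun ξ : V => ‖g ξ‖ ^ 2 := by
    have := (g.memLp 2 volume).integrable_norm_pow (by norm_num)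
    simpa using this
  have h2 : Integrable fun ξ : V => C * (‖ξ‖ ^ 2 * ‖g ξ‖) :=
    (g.integrable_pow_mul volume 2).const_mul C
  have h3 : Integrable fun ξ : V => ‖g ξ‖ ^ 2 + (2 * Real.pi) ^ 2 * (C * (‖ξ‖ ^ 2 * ‖g ξ‖)) :=
    h1.add (h2.const_mul _)
  refine lt_of_le_of_lt ?_ h3.lintegral_lt_top
  apply lintegral_mono
  intro ξ
  dsimp only
  rw [← ofReal_norm, ← ENNReal.ofReal_pow (norm_nonneg _), ← ENNReal.ofReal_mul (by positivity)]
  apply ENNReal.ofReal_le_ofReal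
  have hb : (2 * Real.pi * ‖ξ‖) ^ (2 * s) ≤ 1 + (2 * Real.pi * ‖ξ‖) ^ 2 := by
    rcases le_total (2 * Real.pi * ‖ξ‖) 1 with h | h
    · have := Real.rpow_le_one (by positivity) h (by positivity : 0 ≤ 2 * s)
      nlinarith [sq_nonneg (2 * Real.pi * ‖ξ‖)]
    · have := Real.rpow_le_rpow_of_exponent_le h (by linarith : 2 * s ≤ 2)
      norm_cast at this
      linarith
  calc _ ≤ (1 + (2 * Real.pi * ‖ξ‖) ^ 2) * ‖g ξ‖ ^ 2 := by gcongr
    _ = ‖g ξ‖ ^ 2 + (2 * Real.pi) ^ 2 * (‖g ξ‖ * (‖ξ‖ ^ 2 * ‖g ξ‖)) := by ring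
    _ ≤ _ := by gcongr; exact hC.2 ξ

/-- Smooth compactly supported functions `0 ≤ φ ≤ 1` in `B` whose mean over `B` is close to `1`. -/
theorem exists_contDiff_average_gt {B : Set V} (hB : IsOpen B) (hBf : volume B ≠ ⊤)
    (hB0 : volume B ≠ 0) {ε : ℝ} (hε : 0 < ε) :
    ∃ φ : V → ℝ, ContDiff ℝ (⊤ : ℕ∞) φ ∧ HasCompactSupport φ ∧ tsupport φ ⊆ B ∧
      (∀ x, φ x ∈ Set.Icc 0 1) ∧ 1 - ⨍ x in B, φ x ≤ ε := by
  have hBr : 0 < volume.real B := ENNReal.toReal_pos hB0 hBf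
  -- `K` misses less than the fraction `ε` of the volume of `B`. A cut-off equal to 1 on `K` then
  -- has mean at least `1 - ε`.
  obtain ⟨K, hKB, hK, hKε⟩ := hB.measurableSet.exists_isCompact_lt_add hBf
    (ε := ENNReal.ofReal (ε * volume.real B)) (by simpa using by positivity)
  obtain ⟨K', hK', hKK', hK'B⟩ := exists_compact_between hK hB hKB
  obtain ⟨φ, hφ, hr, hsupp, h1⟩ := exists_contMDiff_support_eq_eq_one_iff
    (modelWithCornersSelf ℝ V) (n := ⊤) isOpen_interior hK.isClosed hKK'
  have hts : tsupport φ ⊆ K' := by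
    rw [tsupport, hsupp]
    exact closure_minimal interior_subset hK'.isClosed
  have hcs : HasCompactSupport φ := hK'.of_isClosed_subset (isClosed_tsupport _) hts
  have hφ' : ContDiff ℝ (⊤ : ℕ∞) φ := hφ.contDiff
  have hm : ∀ x, φ x ∈ Set.Icc 0 1 := fun x => hr ⟨x, rfl⟩
  refine ⟨φ, hφ', hcs, hts.trans hK'B, hm, ?_⟩
  have hi : IntegrableOn φ B := (hφ'.continuous.integrable_of_hasCompactSupport hcs).integrableOn
  have h2 : volume.real K ≤ ∫ x in B, φ x := by
    calc volume.real K = ∫ x in K, φ x := by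
          rw [setIntegral_congr_fun hK.measurableSet (g := fun _ => (1 : ℝ))
            (fun x hx => (h1 x).1 hx)]
          simp
      _ ≤ _ := setIntegral_mono_set hi (ae_of_all _ fun x => (hm x).1)
        (LE.le.eventuallyLE hKB)
  have h3 : volume.real B ≤ volume.real K + ε * volume.real B := by
    have := ENNReal.toReal_mono 
      (ENNReal.add_ne_top.2 ⟨(hK.measure_lt_top (μ := volume)).ne, ENNReal.ofReal_ne_top⟩) hKε.le
    rwa [ENNReal.toReal_add hK.measure_lt_top.ne (by finiteness),
      ENNReal.toReal_ofReal (by positivity)] at this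
  rw [setAverage_eq, smul_eq_mul, ← div_eq_inv_mul, sub_le_iff_le_add, ← sub_le_iff_le_add',
    le_div_iff₀ hBr]
  linarith

end TestFunctions

/-! ### Energies and loads on the cylinder -/

section Cylinder

variable {n k : ℕ} {ω : Set (EuclideanSpace ℝ (Fin n))} {B : Set (EuclideanSpace ℝ (Fin k))}

theorem closure_prodCylinder : closure (prodCylinder ω B) =
    {z : ProdSpace n k | z.fst ∈ closure ω ∧ z.snd ∈ closure B} := by
  have h := (WithLp.homeomorphProd 2 (EuclideanSpace ℝ (Fin n))
    (EuclideanSpace ℝ (Fin k))).preimage_closure (ω ×ˢ B)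
  rw [closure_prod_eq] at h
  exact h.symm

theorem isBounded_prodCylinder (hω : Bornology.IsBounded ω) (hB : Bornology.IsBounded B) :
    Bornology.IsBounded (prodCylinder ω B) := by
  obtain ⟨a, ha⟩ := isBounded_iff_forall_norm_le.1 hω
  obtain ⟨b, hb⟩ := isBounded_iff_forall_norm_le.1 hB
  refine isBounded_iff_forall_norm_le.2 ⟨Real.sqrt (a ^ 2 + b ^ 2), fun z hz => ?_⟩
  apply Real.le_sqrt_of_sq_le
  rw [WithLp.prod_norm_sq_eq_of_L2]
  gcongr
  · exact ha _ hz.1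
  · exact hb _ hz.2

theorem measurableSet_prodCylinder (hω : IsOpen ω) (hB : IsOpen B) :
    MeasurableSet (prodCylinder ω B) := by
  have h1 : Continuous fun z : ProdSpace n k => z.fst := by fun_prop
  have h2 : Continuous fun z : ProdSpace n k => z.snd := by fun_prop
  exact ((hω.preimage h1).inter (hB.preimage h2)).measurableSet

theorem preimage_dilateSnd_prodCylinder {r : ℝ} (hr : 0 < r) :
    dilateSnd r ⁻¹' prodCylinder ω (r • B) = prodCylinder ω B := by
  ext z
  simp [prodCylinder, dilateSnd, Set.smul_mem_smul_set_iff₀ hr.ne']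

theorem ae_fst_zero_of_mem_HTilde {s : ℝ} {v : ProdSpace n k → ℝ}
    (hv : v ∈ HTilde s (prodCylinder ω B)) : ∀ᵐ z, z.fst ∉ closure ω → v z = 0 := by
  filter_upwards [hv.2.2] with z hz h
  refine hz fun h' => h ?_
  rw [closure_prodCylinder] at h'
  exact h'.1

theorem volume_real_smul {r : ℝ} (hr : 0 < r) :
    volume.real (r • B) = r ^ k * volume.real B := by
  rw [Measure.real, Measure.addHaar_smul, ENNReal.toReal_mul, finrank_euclideanSpace_fin,
    abs_of_pos (by positivity), ENNReal.toReal_ofReal (by positivity), Measure.real]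

theorem avg_eq_smul (v : ProdSpace n k → ℝ) :
    avg B v = (volume.real B)⁻¹ • fun x => ∫ t in B, v (WithLp.toLp 2 (x, t)) := by
  funext x
  rw [avg, setAverage_eq, Pi.smul_apply]

theorem avg_tensor (u : EuclideanSpace ℝ (Fin n) → ℝ) (φ : EuclideanSpace ℝ (Fin k) → ℝ) :
    avg B (fun z : ProdSpace n k => u z.fst * φ z.snd) = (⨍ t in B, φ t) • u := by
  funext x
  rw [avg, setAverage_eq, setAverage_eq, Pi.smul_apply, smul_eq_mul, smul_eq_mul, smul_eq_mul]
  refine (congrArg _ (integral_const_mul (u x) φ)).trans ?_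
  ring

/-- Finiteness of the horizontal energy is read off from the undilated case `r = 1`. -/
theorem avg_mem_HTilde {s : ℝ} (hs : 0 ≤ s) (hω : Bornology.IsBounded ω)
    (hB : Bornology.IsBounded B) {v : ProdSpace n k → ℝ} (hv : v ∈ HTilde s (prodCylinder ω B)) :
    avg B v ∈ HTilde s ω := by
  have h1 := integrable_of_mem_HTilde (isBounded_prodCylinder hω hB) hv
  have h0 := ae_fst_zero_of_mem_HTilde hv
  have hBf := (hB.measure_lt_top (μ := volume)).ne
  rw [avg_eq_smul]
  refine Submodule.smul_mem _ _ ⟨memLp_integral_snd hBf hv.1, ?_, integral_snd_ae_zero h0 B⟩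
  refine (fracEnergyE_integral_snd_le s h1 hv.1 isClosed_closure.measurableSet
    hω.closure.measure_lt_top.ne h0 hBf).trans_lt (ENNReal.mul_lt_top hBf.lt_top ?_)
  exact (fstEnergy_le_anisoEnergy hs 1 v).trans_lt (anisoEnergy_lt_top hs 1 h1 hv.1 hv.2.1)

/-- Normalising the average gives `|B|⁻²` and Cauchy–Schwarz gives back `|B|`, which leaves exactly
the normalisation of the stretched energy. This is the energy half of the liminf inequality, valid
for every `r`. -/
theorem fracEnergy_avg_le {s : ℝ} (hs : 0 ≤ s) (hω : Bornology.IsBounded ω)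
    (hB : Bornology.IsBounded B) (r : ℝ) {v : ProdSpace n k → ℝ}
    (hv : v ∈ HTilde s (prodCylinder ω B)) :
    fracEnergy s (avg B v) ≤ (volume.real B)⁻¹ * (anisoEnergy s r v).toReal := by
  have h1 := integrable_of_mem_HTilde (isBounded_prodCylinder hω hB) hv
  have hBf := (hB.measure_lt_top (μ := volume)).ne
  have hf := anisoEnergy_lt_top hs r h1 hv.1 hv.2.1
  have h := (fracEnergyE_integral_snd_le s h1 hv.1 isClosed_closure.measurableSet
    hω.closure.measure_lt_top.ne (ae_fst_zero_of_mem_HTilde hv) hBf).trans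
    (mul_le_mul_right (fstEnergy_le_anisoEnergy hs r v) _)
  have h' := ENNReal.toReal_mono (ENNReal.mul_ne_top hBf hf.ne) h
  rw [ENNReal.toReal_mul] at h'
  rw [avg_eq_smul, fracEnergy, fracEnergyE_smul s _ (memLp_integral_snd hBf hv.1),
    ENNReal.toReal_mul, ENNReal.toReal_pow, toReal_enorm, Real.norm_of_nonneg (by positivity)]
  -- If `B` is null, both sides vanish by the convention `0⁻¹ = 0`.
  rcases eq_or_ne (volume.real B) 0 with h0 | h0
  · simp [h0]
  · calc _ ≤ (volume.real B)⁻¹ ^ 2 * (volume.real B * (anisoEnergy s r v).toReal) := by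
          gcongr; exact h'
      _ = _ := by field_simp

theorem fracEnergy_stretch {s : ℝ} {r : ℝ} (hr : 0 < r) {v : ProdSpace n k → ℝ}
    (h1 : Integrable v) (h2 : MemLp v 2 volume) :
    (volume.real (r • B))⁻¹ * fracEnergy s (stretch r v) =
      (volume.real B)⁻¹ * (anisoEnergy s r v).toReal := by
  rw [volume_real_smul hr, fracEnergy]
  change _ * (fracEnergyE s fun z => v (dilateSnd r⁻¹ z)).toReal = _
  rw [fracEnergyE_comp_dilateSnd_inv s hr h1 h2, ENNReal.toReal_mul,
    ENNReal.toReal_ofReal (by positivity), finrank_euclideanSpace_fin]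
  field_simp

theorem setIntegral_stretch {r : ℝ} (hr : 0 < r) (g v : ProdSpace n k → ℝ) :
    (volume.real (r • B))⁻¹ * ∫ z in prodCylinder ω (r • B), g z * stretch r v z =
      (volume.real B)⁻¹ * ∫ z in prodCylinder ω B, g (dilateSnd r z) * v z := by
  have h := setIntegral_comp_dilateSnd hr (fun z => g z * stretch r v z)
    (prodCylinder ω (r • B))
  have e : ∀ z : ProdSpace n k, stretch r v (dilateSnd r z) = v z := fun z =>
    congrArg v (dilateSnd_inv_dilateSnd hr.ne' z)
  simp only [preimage_dilateSnd_prodCylinder hr, e, finrank_euclideanSpace_fin] at h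
  rw [h, volume_real_smul hr, mul_inv]
  ring

theorem tensor_indicator_eq (f : EuclideanSpace ℝ (Fin n) → ℝ) :
    (fun z : ProdSpace n k => ω.indicator f z.fst * B.indicator (fun _ => (1 : ℝ)) z.snd) =
      (prodCylinder ω B).indicator fun z => f z.fst := by
  funext z
  by_cases h1 : z.fst ∈ ω <;> by_cases h2 : z.snd ∈ B <;>
    simp [prodCylinder, Set.indicator, h1, h2]

theorem memLp_indicator_comp_fst (hω : IsOpen ω) (hB : IsOpen B) (hBf : volume B ≠ ⊤)
    {f : EuclideanSpace ℝ (Fin n) → ℝ} (hf : MemLp f 2 (volume.restrict ω)) :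
    MemLp ((prodCylinder ω B).indicator fun z => f z.fst) 2 volume := by
  rw [← tensor_indicator_eq]
  exact memLp_tensor ((memLp_indicator_iff_restrict hω.measurableSet).2 hf)
    (memLp_indicator_const 2 hB.measurableSet 1 (Or.inr hBf))

/-- A load independent of `t` sees `v` only through its average. This is why `ρ` is the right map
for the limit. -/
theorem setIntegral_fst_mul (hω : IsOpen ω) (hB : IsOpen B) (hBf : volume B ≠ ⊤)
    {f : EuclideanSpace ℝ (Fin n) → ℝ} (hf : MemLp f 2 (volume.restrict ω))
    {v : ProdSpace n k → ℝ} (hv : MemLp v 2 volume) :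
    (volume.real B)⁻¹ * ∫ z in prodCylinder ω B, f z.fst * v z = ∫ x in ω, f x * avg B v x := by
  have hi : Integrable fun z => (prodCylinder ω B).indicator (fun z => f z.fst) z * v z :=
    (memLp_indicator_comp_fst hω hB hBf hf).integrable_mul hv
  have e1 : ∫ z in prodCylinder ω B, f z.fst * v z =
      ∫ z, (prodCylinder ω B).indicator (fun z => f z.fst) z * v z := by
    rw [← integral_indicator (measurableSet_prodCylinder hω hB)]
    congr 1 with z
    rw [Set.indicator_mul_left]
  rw [e1, integral_withLp_prod, integral_prod _ (integrable_comp_toLp_prod hi),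
    ← integral_indicator hω.measurableSet, ← integral_const_mul]
  congr 1 with x
  by_cases hx : x ∈ ω
  · rw [Set.indicator_of_mem hx, avg_eq_smul, Pi.smul_apply, smul_eq_mul, mul_left_comm,
      ← integral_indicator hB.measurableSet]
    congr 1
    rw [← integral_const_mul]
    congr 1 with t
    by_cases ht : t ∈ B
    · simp [prodCylinder, Set.indicator, hx, ht]
    · simp [prodCylinder, Set.indicator, ht]
  · simp [prodCylinder, Set.indicator, hx]

/-- Splitting of the rescaled energy into the limit load and a small error. -/
theorem abs_rescaledEnergy_sub_le {s : ℝ} (hω : IsOpen ω) (hωb : Bornology.IsBounded ω)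
    (hB : IsOpen B) (hBb : Bornology.IsBounded B) {r : ℝ} (hr : 0 < r) {g : ProdSpace n k → ℝ}
    (hg : MemLp g 2 (volume.restrict (prodCylinder ω (r • B))))
    {f : EuclideanSpace ℝ (Fin n) → ℝ} (hf : MemLp f 2 (volume.restrict ω))
    {v : ProdSpace n k → ℝ} (hv : v ∈ HTilde s (prodCylinder ω B)) :
    |rescaledEnergy s ω B r g v - (1 / 2 * ((volume.real B)⁻¹ * (anisoEnergy s r v).toReal)
        - ∫ x in ω, f x * avg B v x)| ≤
      (volume.real B)⁻¹ * ((eLpNorm (fun z => g (dilateSnd r z) - f z.fst) 2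
        (volume.restrict (prodCylinder ω B))).toReal * (eLpNorm v 2 volume).toReal) := by
  have h1 := integrable_of_mem_HTilde (isBounded_prodCylinder hωb hBb) hv
  have hBf := (hBb.measure_lt_top (μ := volume)).ne
  have hg' : MemLp (fun z => g (dilateSnd r z)) 2 (volume.restrict (prodCylinder ω B)) := by
    have := memLp_comp_dilateSnd hr hg
    rwa [preimage_dilateSnd_prodCylinder hr] at this
  have hf' : MemLp (fun z : ProdSpace n k => f z.fst) 2 (volume.restrict (prodCylinder ω B)) :=
    (memLp_indicator_iff_restrict (measurableSet_prodCylinder hω hB)).1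
      (memLp_indicator_comp_fst hω hB hBf hf)
  have hv' : MemLp v 2 (volume.restrict (prodCylinder ω B)) :=
    hv.1.mono_measure Measure.restrict_le_self
  have hd : (∫ z in prodCylinder ω B, g (dilateSnd r z) * v z) -
      ∫ z in prodCylinder ω B, f z.fst * v z =
      ∫ z in prodCylinder ω B, (g (dilateSnd r z) - f z.fst) * v z := by
    simp_rw [sub_mul]
    exact (integral_sub (hg'.integrable_mul hv') (hf'.integrable_mul hv')).symm
  rw [rescaledEnergy, fracEnergy_stretch hr h1 hv.1, setIntegral_stretch hr,
    ← setIntegral_fst_mul hω hB hBf hf hv.1, sub_sub_sub_cancel_left, ← mul_sub, abs_mul,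
    abs_of_nonneg (by positivity), abs_sub_comm, hd]
  gcongr
  refine (abs_integral_mul_le_eLpNorm_mul_eLpNorm (hg'.sub hf') hv').trans ?_
  exact mul_le_mul_of_nonneg_left (ENNReal.toReal_mono hv.1.2.ne
    (eLpNorm_mono_measure _ Measure.restrict_le_self)) ENNReal.toReal_nonneg

/-- Poincaré inequality for the stretched energies, uniform in the stretching. -/
theorem exists_poincare_cylinder (hn : 1 ≤ n) {s : ℝ} (hs : 0 < s)
    (hω : Bornology.IsBounded ω) (hB : Bornology.IsBounded B) :
    ∃ C : ℝ, 0 ≤ C ∧ ∀ v ∈ HTilde s (prodCylinder ω B), ∀ r : ℝ,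
      (eLpNorm v 2 volume).toReal ^ 2 ≤ C * (anisoEnergy s r v).toReal := by
  have : Nonempty (Fin n) := ⟨⟨0, hn⟩⟩
  obtain ⟨C, hC, h⟩ := exists_poincare_fst (E := EuclideanSpace ℝ (Fin n))
    (F := EuclideanSpace ℝ (Fin k)) hs isClosed_closure.measurableSet
    (hω.closure.measure_lt_top (μ := volume)).ne
  refine ⟨C.toReal, ENNReal.toReal_nonneg, fun v hv r => ?_⟩
  have h1 := integrable_of_mem_HTilde (isBounded_prodCylinder hω hB) hv
  have h2 := h (fun z => (v z : ℂ)) h1.ofReal hv.1.ofReal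
    ((ae_fst_zero_of_mem_HTilde hv).mono fun z hz hzA => by simp [hz hzA])
  have h3 : ∫⁻ z, ‖(v z : ℂ)‖ₑ ^ 2 = eLpNorm v 2 volume ^ 2 := by
    rw [← lintegral_enorm_sq_eq_eLpNorm_sq]
    simp [enorm_eq_nnnorm]
  rw [h3] at h2
  have h4 := h2.trans (mul_le_mul_right (fstEnergy_le_anisoEnergy hs.le r v) _)
  have h5 := ENNReal.toReal_mono
    (ENNReal.mul_ne_top hC (anisoEnergy_lt_top hs.le r h1 hv.1 hv.2.1).ne) h4
  rwa [ENNReal.toReal_pow, ENNReal.toReal_mul] at h5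

theorem tensor_mem_HTilde {s : ℝ} (hs0 : 0 ≤ s) (hs1 : s ≤ 1) (hω : Bornology.IsBounded ω)
    {u : EuclideanSpace ℝ (Fin n) → ℝ} (hu : u ∈ HTilde s ω)
    {φ : EuclideanSpace ℝ (Fin k) → ℝ} (hφ : ContDiff ℝ (⊤ : ℕ∞) φ) (hφc : HasCompactSupport φ)
    (hφB : tsupport φ ⊆ B) :
    (fun z : ProdSpace n k => u z.fst * φ z.snd) ∈ HTilde s (prodCylinder ω B) := by
  have hu1 := integrable_of_mem_HTilde hω hu
  have hφ1 : Integrable φ := hφ.continuous.integrable_of_hasCompactSupport hφc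
  have hφ2 : MemLp φ 2 volume := hφ.continuous.memLp_of_hasCompactSupport hφc
  have hm := memLp_tensor hu.1 hφ2
  refine ⟨hm, ?_, ?_⟩
  -- The dilation with `r = 1` is the identity, so the tensor estimate for `anisoEnergy` also gives
  -- finiteness of the ordinary energy.
  · have h := fracEnergyE_comp_dilateSnd_inv s one_pos (integrable_tensor hu1 hφ1) hm
    have e : (fun z : ProdSpace n k => u (dilateSnd 1⁻¹ z).fst * φ (dilateSnd 1⁻¹ z).snd) =
        fun z => u z.fst * φ z.snd := by
      funext z
      simp [dilateSnd]
    rw [e] at h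
    rw [h]
    refine ENNReal.mul_lt_top ENNReal.ofReal_lt_top
      ((anisoEnergy_tensor_le hs0 hs1 one_pos hu1 hu.1 hφ1 hφ2).trans_lt ?_)
    exact ENNReal.add_lt_top.2
      ⟨ENNReal.mul_lt_top hu.2.1 (lintegral_enorm_sq_lt_top hφ2),
      ENNReal.mul_lt_top ENNReal.ofReal_lt_top (ENNReal.mul_lt_top (lintegral_enorm_sq_lt_top hu.1)
        (fracEnergyE_lt_top_of_contDiff hs0 hs1 hφ hφc))⟩
  · have h := (WithLp.volume_preserving_ofLp (EuclideanSpace ℝ (Fin n))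
      (EuclideanSpace ℝ (Fin k))).quasiMeasurePreserving.ae
      (Measure.quasiMeasurePreserving_fst.ae hu.2.2)
    filter_upwards [h] with z hz hzc
    rw [closure_prodCylinder] at hzc
    by_cases h1 : z.fst ∈ closure ω
    · have h2 : z.snd ∉ tsupport φ := fun h2 => hzc ⟨h1, subset_closure (hφB h2)⟩
      rw [image_eq_zero_of_notMem_tsupport h2, mul_zero]
    · exact mul_eq_zero_of_left (hz h1) _

theorem lintegral_enorm_sq_le_of_cutoff (hB : IsOpen B) {φ : EuclideanSpace ℝ (Fin k) → ℝ}
    (hφB : tsupport φ ⊆ B) (hφ01 : ∀ t, φ t ∈ Set.Icc 0 1) :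
    ∫⁻ t, ‖φ t‖ₑ ^ 2 ≤ volume B := by
  rw [← lintegral_indicator_one hB.measurableSet]
  apply lintegral_mono
  intro t
  dsimp only
  by_cases ht : t ∈ B
  · rw [Set.indicator_of_mem ht, Pi.one_apply, Real.enorm_eq_ofReal (hφ01 t).1]
    exact pow_le_one₀ zero_le (ENNReal.ofReal_le_one.2 (hφ01 t).2)
  · rw [image_eq_zero_of_notMem_tsupport fun h => ht (hφB h)]
    simp

/-- Since `0 ≤ φ ≤ 1` with support in `B`, `‖φ‖² ≤ |B|`. The normalisation cancels this factor and
`ℰ(u)` appears with constant exactly 1. -/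
theorem anisoEnergy_tensor_average_le {s : ℝ} (hs0 : 0 ≤ s) (hs1 : s ≤ 1)
    (hω : Bornology.IsBounded ω) (hB : IsOpen B) (hBf : volume B ≠ ⊤) (hB0 : volume B ≠ 0) {r : ℝ}
    (hr : 0 < r) {u : EuclideanSpace ℝ (Fin n) → ℝ} (hu : u ∈ HTilde s ω)
    {φ : EuclideanSpace ℝ (Fin k) → ℝ} (hφ : ContDiff ℝ (⊤ : ℕ∞) φ) (hφc : HasCompactSupport φ)
    (hφB : tsupport φ ⊆ B) (hφ01 : ∀ t, φ t ∈ Set.Icc 0 1) :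
    (volume.real B)⁻¹ *
        (anisoEnergy s r (fun z : ProdSpace n k => u z.fst * φ z.snd)).toReal ≤
      fracEnergy s u + (volume.real B)⁻¹ * (eLpNorm u 2 volume).toReal ^ 2 *
        (r⁻¹ ^ (2 * s) * fracEnergy s φ) := by
  have hBr : 0 < volume.real B := ENNReal.toReal_pos hB0 hBf
  have hφ1 : Integrable φ := hφ.continuous.integrable_of_hasCompactSupport hφc
  have hφ2 : MemLp φ 2 volume := hφ.continuous.memLp_of_hasCompactSupport hφc
  have hφB' := lintegral_enorm_sq_le_of_cutoff hB hφB hφ01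
  have hφe := fracEnergyE_lt_top_of_contDiff hs0 hs1 hφ hφc
  have h := (anisoEnergy_tensor_le hs0 hs1 hr (integrable_of_mem_HTilde hω hu) hu.1 hφ1
    hφ2).trans (add_le_add_left (mul_le_mul_right hφB' _) _)
  have hu2 := lintegral_enorm_sq_lt_top hu.1
  have t1 := ENNReal.mul_ne_top hu.2.1.ne hBf
  have t2 := ENNReal.mul_ne_top (ENNReal.ofReal_ne_top (r := r⁻¹ ^ (2 * s)))
    (ENNReal.mul_ne_top hu2.ne hφe.ne)
  have h' := ENNReal.toReal_mono (ENNReal.add_ne_top.2 ⟨t1, t2⟩) h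
  rw [ENNReal.toReal_add t1 t2, ENNReal.toReal_mul, ENNReal.toReal_mul, ENNReal.toReal_mul,
    ENNReal.toReal_ofReal (by positivity), lintegral_enorm_sq_eq_eLpNorm_sq,
    ENNReal.toReal_pow] at h'
  calc _ ≤ (volume.real B)⁻¹ * (fracEnergy s u * volume.real B +
        r⁻¹ ^ (2 * s) * ((eLpNorm u 2 volume).toReal ^ 2 * fracEnergy s φ)) := by
        gcongr; exact h'
    _ = _ := by field_simp

theorem eLpNorm_tensor {u : EuclideanSpace ℝ (Fin n) → ℝ} (hu : MemLp u 2 volume)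
    {φ : EuclideanSpace ℝ (Fin k) → ℝ} (hφ : MemLp φ 2 volume) :
    (eLpNorm (fun z : ProdSpace n k => u z.fst * φ z.snd) 2 volume).toReal ^ 2 =
      (eLpNorm u 2 volume).toReal ^ 2 * (eLpNorm φ 2 volume).toReal ^ 2 := by
  simp only [← ENNReal.toReal_pow, ← lintegral_enorm_sq_eq_eLpNorm_sq, ← ENNReal.toReal_mul]
  rw [lintegral_enorm_sq_tensor hu.1 hφ.1]

/-- Cut-off functions in `B` with mean tending to `1` and controlled energy. -/
theorem exists_cutoff_sequence {s : ℝ} (hs0 : 0 < s) (hB : IsOpen B)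
    (hBf : volume B ≠ ⊤) (hB0 : volume B ≠ 0) {ℓ : ℕ → ℝ} (hℓ : ∀ j, 0 < ℓ j)
    (hℓlim : Tendsto ℓ atTop atTop) :
    ∃ φ : ℕ → EuclideanSpace ℝ (Fin k) → ℝ,
      (∀ j, ContDiff ℝ (⊤ : ℕ∞) (φ j) ∧ HasCompactSupport (φ j) ∧ tsupport (φ j) ⊆ B ∧
        ∀ t, φ j t ∈ Set.Icc 0 1) ∧
      Tendsto (fun j => ⨍ t in B, φ j t) atTop (𝓝 1) ∧
      Tendsto (fun j => (ℓ j)⁻¹ ^ (2 * s) * fracEnergy s (φ j)) atTop (𝓝 0) := by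
  set S : Set (EuclideanSpace ℝ (Fin k) → ℝ) := {φ | ContDiff ℝ (⊤ : ℕ∞) φ ∧
    HasCompactSupport φ ∧ tsupport φ ⊆ B ∧ ∀ t, φ t ∈ Set.Icc 0 1} with hS
  have hBr : 0 < volume.real B := ENNReal.toReal_pos hB0 hBf
  have hmean : ∀ φ ∈ S, 0 ≤ 1 - ⨍ t in B, φ t := by
    rintro φ ⟨h1, h2, -, h4⟩
    have hi : IntegrableOn φ B := (h1.continuous.integrable_of_hasCompactSupport h2).integrableOn
    have : ∫ t in B, φ t ≤ ∫ t in B, (1 : ℝ) :=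
      integral_mono hi (integrableOn_const hBf) fun t => (h4 t).2
    rw [setAverage_eq, smul_eq_mul, ← div_eq_inv_mul, sub_nonneg, div_le_one hBr]
    simpa using this
  have hen : ∀ (j : ℕ) (φ : EuclideanSpace ℝ (Fin k) → ℝ),
      0 ≤ (ℓ j)⁻¹ ^ (2 * s) * fracEnergy s φ := fun j φ =>
    mul_nonneg (Real.rpow_nonneg (inv_nonneg.2 (hℓ j).le) _) ENNReal.toReal_nonneg
  -- The mean defect and the scaled energy compete. Minimising their sum up to `1 / (j + 1)` at each
  -- `j` replaces an explicit diagonal choice, and both terms are nonnegative.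
  set Q : ℕ → (EuclideanSpace ℝ (Fin k) → ℝ) → ℝ := fun j φ =>
    (1 - ⨍ t in B, φ t) + (ℓ j)⁻¹ ^ (2 * s) * fracEnergy s φ with hQ
  have hex : ∀ j : ℕ, ∃ φ ∈ S, ∀ ψ ∈ S, Q j φ ≤ Q j ψ + 1 / ((j : ℝ) + 1) := by
    intro j
    have hne : (Q j '' S).Nonempty := by
      obtain ⟨ψ, h1, h2, h3, h4, -⟩ := exists_contDiff_average_gt hB hBf hB0 one_pos
      exact ⟨_, ψ, ⟨h1, h2, h3, h4⟩, rfl⟩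
    have hbdd : BddBelow (Q j '' S) :=
      ⟨0, by rintro _ ⟨ψ, hψ, rfl⟩; exact add_nonneg (hmean ψ hψ) (hen j ψ)⟩
    obtain ⟨_, ⟨φ, hφ, rfl⟩, h⟩ := exists_lt_of_csInf_lt hne
      (lt_add_of_pos_right (sInf (Q j '' S)) (by positivity : (0 : ℝ) < 1 / ((j : ℝ) + 1)))
    refine ⟨φ, hφ, fun ψ hψ => h.le.trans ?_⟩
    gcongr
    exact csInf_le hbdd ⟨ψ, hψ, rfl⟩
  choose φ hφS hφQ using hex
  have hpow : Tendsto (fun j => (ℓ j)⁻¹ ^ (2 * s)) atTop (𝓝 0) := by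
    have := (tendsto_rpow_neg_atTop (by positivity : 0 < 2 * s)).comp hℓlim
    refine this.congr fun j => ?_
    rw [Function.comp_apply, Real.rpow_neg (hℓ j).le, Real.inv_rpow (hℓ j).le]
  have hlim : Tendsto (fun j => Q j (φ j)) atTop (𝓝 0) := by
    have hQ0 : ∀ j, 0 ≤ Q j (φ j) := fun j => add_nonneg (hmean _ (hφS j)) (hen _ _)
    rw [Metric.tendsto_atTop']
    intro ε hε
    -- Comparison with one fixed `ψ` of mean defect at most `ε / 2`: its energy does not depend on
    -- `j`, so the factor `ℓ_j^(-2s)` kills it.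
    obtain ⟨ψ, h1, h2, h3, h4, h5⟩ := exists_contDiff_average_gt hB hBf hB0 (half_pos hε)
    have hψ : Tendsto (fun j : ℕ => (1 - ⨍ t in B, ψ t) + (ℓ j)⁻¹ ^ (2 * s) * fracEnergy s ψ +
        1 / ((j : ℝ) + 1)) atTop (𝓝 ((1 - ⨍ t in B, ψ t) + 0 * fracEnergy s ψ + 0)) :=
      (tendsto_const_nhds.add (hpow.mul_const _)).add tendsto_one_div_add_atTop_nhds_zero_nat
    have := (hψ.eventually_lt_const (u := ε) (by linarith)).and (eventually_ge_atTop 0)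
    obtain ⟨N, hN⟩ := eventually_atTop.1 this
    refine ⟨N, fun j hj => ?_⟩
    rw [Real.dist_eq, sub_zero, abs_of_nonneg (hQ0 j)]
    exact (hφQ j ψ ⟨h1, h2, h3, h4⟩).trans_lt (hN j hj.le).1
  refine ⟨φ, hφS, ?_, ?_⟩
  · have h : Tendsto (fun j => 1 - ⨍ t in B, φ j t) atTop (𝓝 0) :=
      squeeze_zero (fun j => hmean _ (hφS j)) (fun j => le_add_of_nonneg_right (hen _ _)) hlim
    simpa using h.const_sub 1
  · exact squeeze_zero (fun j => hen _ _) (fun j => le_add_of_nonneg_left (hmean _ (hφS j))) hlim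

end Cylinder

/-! ### The two Γ-convergence inequalities -/

section GammaLimit

variable {n k : ℕ} {ω : Set (EuclideanSpace ℝ (Fin n))} {B : Set (EuclideanSpace ℝ (Fin k))}
  {s : ℝ} {ℓ : ℕ → ℝ} {f : ℝ → ProdSpace n k → ℝ} {f_inf : EuclideanSpace ℝ (Fin n) → ℝ}

/-- The norm of the difference between the rescaled load and its limit. -/
noncomputable def loadError (ω : Set (EuclideanSpace ℝ (Fin n)))
    (B : Set (EuclideanSpace ℝ (Fin k))) (ℓ : ℝ) (g : ProdSpace n k → ℝ)
    (f_inf : EuclideanSpace ℝ (Fin n) → ℝ) : ℝ :=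
  (eLpNorm (fun z => g (dilateSnd ℓ z) - f_inf z.fst) 2
    (volume.restrict (prodCylinder ω B))).toReal

theorem le_liminf_rescaledEnergy (hn : 1 ≤ n) (hs0 : 0 < s)
    (hω : IsOpen ω) (hωb : Bornology.IsBounded ω) (hB : IsOpen B) (hBb : Bornology.IsBounded B)
    (hℓ : ∀ j, 0 < ℓ j)
    (hf : ∀ j, MemLp (f (ℓ j)) 2 (volume.restrict (prodCylinder ω (ℓ j • B))))
    (hf_inf : MemLp f_inf 2 (volume.restrict ω))
    (hlim : Tendsto (fun j => loadError ω B (ℓ j) (f (ℓ j)) f_inf) atTop (𝓝 0))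
    {u : EuclideanSpace ℝ (Fin n) → ℝ} {v : ℕ → ProdSpace n k → ℝ}
    (hv : ∀ j, v j ∈ HTilde s (prodCylinder ω B))
    (hw : WeakTendsto s ω (fun j => avg B (v j)) u) :
    (limitEnergy s ω f_inf u : EReal) ≤
      liminf (fun j => (rescaledEnergy s ω B (ℓ j) (f (ℓ j)) (v j) : EReal)) atTop := by
  obtain ⟨a, ha, hae⟩ := hw.exists_tendsto_fracEnergy
  have hload := hw.tendsto_setIntegral_mul hf_inf
  obtain ⟨C, hC, hP⟩ := exists_poincare_cylinder (k := k) hn hs0 hωb hBb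
  set β := (volume.real B)⁻¹ with hβ
  have hβ0 : 0 ≤ β := by positivity
  set δ : ℕ → ℝ := fun j => loadError ω B (ℓ j) (f (ℓ j)) f_inf with hδ
  have hδ0 : ∀ j, 0 ≤ δ j := fun j => ENNReal.toReal_nonneg
  -- The factor `1 - C δ_j` is what remains of the energy after part of it has absorbed the load
  -- error.
  have hlow : Tendsto (fun j => 1 / 2 * a j * (1 - C * δ j)
      - (∫ x in ω, f_inf x * avg B (v j) x) - β / 2 * δ j) atTop
      (𝓝 (1 / 2 * fracEnergy s u * (1 - C * 0) - (∫ x in ω, f_inf x * u x) - β / 2 * 0)) :=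
    (((ha.const_mul _).mul ((hlim.const_mul C).const_sub 1)).sub hload).sub (hlim.const_mul _)
  have hlim' : 1 / 2 * fracEnergy s u * (1 - C * 0) - (∫ x in ω, f_inf x * u x) - β / 2 * 0 =
      limitEnergy s ω f_inf u := by
    rw [limitEnergy]; ring
  rw [hlim'] at hlow
  rw [← ((continuous_coe_real_ereal.tendsto _).comp hlow).liminf_eq]
  refine liminf_le_liminf ?_
  -- This keeps `1 - C δ_j` positive, so the lower bound `a j` for the energy may be multiplied by
  -- it.
  have hsmall : ∀ᶠ j in atTop, C * δ j < 1 := by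
    have := hlim.const_mul C
    rw [mul_zero] at this
    exact this.eventually_lt_const one_pos
  filter_upwards [hsmall] with j hj
  rw [Function.comp_apply, EReal.coe_le_coe_iff]
  have h1 := (abs_le.1 (abs_rescaledEnergy_sub_le hω hωb hB hBb (hℓ j) (hf j) hf_inf (hv j))).1
  have h2 := hP (v j) (hv j) (ℓ j)
  have h3 := (hae j).trans (fracEnergy_avg_le hs0.le hωb hBb (ℓ j) (hv j))
  have h4 : 0 ≤ (anisoEnergy s (ℓ j) (v j)).toReal := ENNReal.toReal_nonneg
  change -(β * (δ j * _)) ≤ _ at h1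
  rw [← hβ] at h1 h3
  set e := (anisoEnergy s (ℓ j) (v j)).toReal
  set N := (eLpNorm (v j) 2 volume).toReal
  -- From `N ≤ (1 + N²) / 2` and Poincaré: the error, linear in `N`, becomes linear in the energy
  -- `e` and can be absorbed.
  have h5 : N ≤ (1 + C * e) / 2 := by nlinarith [sq_nonneg (N - 1)]
  have h6 : β * (δ j * N) ≤ β * (δ j * ((1 + C * e) / 2)) := by
    have := hδ0 j
    gcongr
  have h7 : a j * (1 - C * δ j) ≤ β * e * (1 - C * δ j) :=
    mul_le_mul_of_nonneg_right h3 (by linarith)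
  linarith

theorem limsup_rescaledEnergy_le (hs0 : 0 < s) (hs1 : s < 1)
    (hω : IsOpen ω) (hωb : Bornology.IsBounded ω) (hB : IsOpen B) (hBb : Bornology.IsBounded B)
    (hB0 : volume B ≠ 0) (hℓ : ∀ j, 0 < ℓ j)
    (hf : ∀ j, MemLp (f (ℓ j)) 2 (volume.restrict (prodCylinder ω (ℓ j • B))))
    (hf_inf : MemLp f_inf 2 (volume.restrict ω))
    (hlim : Tendsto (fun j => loadError ω B (ℓ j) (f (ℓ j)) f_inf) atTop (𝓝 0))
    {φ : ℕ → EuclideanSpace ℝ (Fin k) → ℝ}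
    (hφ : ∀ j, ContDiff ℝ (⊤ : ℕ∞) (φ j) ∧ HasCompactSupport (φ j) ∧ tsupport (φ j) ⊆ B ∧
      ∀ t, φ j t ∈ Set.Icc 0 1)
    (hφ1 : Tendsto (fun j => ⨍ t in B, φ j t) atTop (𝓝 1))
    (hφe : Tendsto (fun j => (ℓ j)⁻¹ ^ (2 * s) * fracEnergy s (φ j)) atTop (𝓝 0))
    {u : EuclideanSpace ℝ (Fin n) → ℝ} (hu : u ∈ HTilde s ω) :
    limsup (fun j => (rescaledEnergy s ω B (ℓ j) (f (ℓ j))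
      (fun z => u z.fst * φ j z.snd) : EReal)) atTop ≤ (limitEnergy s ω f_inf u : EReal) := by
  have hBf := (hBb.measure_lt_top (μ := volume)).ne
  set β := (volume.real B)⁻¹ with hβ
  have hβ0 : 0 ≤ β := by positivity
  set δ : ℕ → ℝ := fun j => loadError ω B (ℓ j) (f (ℓ j)) f_inf with hδ
  have hδ0 : ∀ j, 0 ≤ δ j := fun j => ENNReal.toReal_nonneg
  set U := (eLpNorm u 2 volume).toReal with hU
  set M := U ^ 2 * volume.real B with hM
  -- Here `M` bounds `‖u φ_j‖²` uniformly in `j`, so the load error vanishes without Poincaré's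
  -- inequality.
  have hup : Tendsto (fun j => 1 / 2 * (fracEnergy s u + β * U ^ 2 *
        ((ℓ j)⁻¹ ^ (2 * s) * fracEnergy s (φ j)))
      - (⨍ t in B, φ j t) * (∫ x in ω, f_inf x * u x) + β * (δ j * ((1 + M) / 2))) atTop
      (𝓝 (1 / 2 * (fracEnergy s u + β * U ^ 2 * 0) - 1 * (∫ x in ω, f_inf x * u x)
        + β * (0 * ((1 + M) / 2)))) :=
    ((((hφe.const_mul _).const_add _).const_mul _).sub (hφ1.mul_const _)).add
      ((hlim.mul_const _).const_mul _)
  have hlim' : 1 / 2 * (fracEnergy s u + β * U ^ 2 * 0) - 1 * (∫ x in ω, f_inf x * u x)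
        + β * (0 * ((1 + M) / 2)) = limitEnergy s ω f_inf u := by
    rw [limitEnergy]; ring
  rw [hlim'] at hup
  rw [← ((continuous_coe_real_ereal.tendsto _).comp hup).limsup_eq]
  refine limsup_le_limsup ?_
  filter_upwards with j
  rw [Function.comp_apply, EReal.coe_le_coe_iff]
  obtain ⟨h1, h2, h3, h4⟩ := hφ j
  have hφ2 : MemLp (φ j) 2 volume := h1.continuous.memLp_of_hasCompactSupport h2
  have hv := tensor_mem_HTilde hs0.le hs1.le hωb hu h1 h2 h3
  have e1 := (abs_le.1 (abs_rescaledEnergy_sub_le hω hωb hB hBb (hℓ j) (hf j) hf_inf hv)).2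
  have e2 := anisoEnergy_tensor_average_le hs0.le hs1.le hωb hB hBf hB0 (hℓ j) hu h1 h2 h3 h4
  have e3 := eLpNorm_tensor hu.1 hφ2
  have e4 : (eLpNorm (φ j) 2 volume).toReal ^ 2 ≤ volume.real B := by
    rw [← ENNReal.toReal_pow, ← lintegral_enorm_sq_eq_eLpNorm_sq]
    exact ENNReal.toReal_mono hBf (lintegral_enorm_sq_le_of_cutoff hB h3 h4)
  have e5 : ∫ x in ω, f_inf x * avg B (fun z : ProdSpace n k => u z.fst * φ j z.snd) x =
      (⨍ t in B, φ j t) * ∫ x in ω, f_inf x * u x := by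
    rw [avg_tensor, ← integral_const_mul]
    congr 1 with x
    rw [Pi.smul_apply, smul_eq_mul]
    ring
  rw [e5] at e1
  change _ ≤ β * (δ j * _) at e1
  rw [← hβ] at e1 e2
  set N := (eLpNorm (fun z : ProdSpace n k => u z.fst * φ j z.snd) 2 volume).toReal
  have h5 : N ≤ (1 + M) / 2 := by
    have : N ^ 2 ≤ M := e3.trans_le (by rw [hM]; gcongr)
    nlinarith [sq_nonneg (N - 1)]
  have h6 : β * (δ j * N) ≤ β * (δ j * ((1 + M) / 2)) := by
    have := hδ0 j
    gcongr
  linarith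

/-- The averages of the recovery sequence are multiples of `u` by the means of the cut-offs, so
linearity of the test functional is enough. -/
theorem weakTendsto_const_smul {u : EuclideanSpace ℝ (Fin n) → ℝ} (hu : u ∈ HTilde s ω)
    {c : ℕ → ℝ} (hc : Tendsto c atTop (𝓝 1)) : WeakTendsto s ω (fun j => c j • u) u := by
  refine ⟨fun j => Submodule.smul_mem _ _ hu, hu, fun L _ => ?_⟩
  have e : ∀ j, L ⟨c j • u, Submodule.smul_mem _ _ hu⟩ = c j * L ⟨u, hu⟩ := fun j =>
    L.map_smul (c j) ⟨u, hu⟩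
  simp_rw [e]
  simpa using hc.mul_const (L ⟨u, hu⟩)

end GammaLimit

theorem theorem3p3 (n k : ℕ) (hn : 1 ≤ n) (hk : 1 ≤ k) (s : ℝ) (hs0 : 0 < s) (hs1 : s < 1)
    -- the section `ω` and the convex neighbourhood `B` of the origin
    (ω : Set (EuclideanSpace ℝ (Fin n))) (hω : IsOpen ω) (hωb : Bornology.IsBounded ω)
    (B : Set (EuclideanSpace ℝ (Fin k))) (hB : IsOpen B) (hBb : Bornology.IsBounded B)
    (hBc : Convex ℝ B) (hB0 : (0 : EuclideanSpace ℝ (Fin k)) ∈ B)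
    -- an arbitrary divergent sequence `ℓ j → ∞`
    (ℓ : ℕ → ℝ) (hℓ : ∀ j, 0 < ℓ j) (hℓlim : Tendsto ℓ atTop atTop)
    -- loads `f (ℓ j) ∈ L²(ω × ℓ j B)` whose rescalings converge to `f_∞` in `L²(ω × B)`
    (f : ℝ → ProdSpace n k → ℝ)
    (hf : ∀ j, MemLp (f (ℓ j)) 2 (volume.restrict (prodCylinder ω (ℓ j • B))))
    (f_inf : EuclideanSpace ℝ (Fin n) → ℝ) (hf_inf : MemLp f_inf 2 (volume.restrict ω))
    (hlim : Tendsto (fun j => eLpNorm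
        (fun z : ProdSpace n k => f (ℓ j) (WithLp.toLp 2 (z.fst, ℓ j • z.snd)) - f_inf z.fst)
        2 (volume.restrict (prodCylinder ω B))) atTop (𝓝 0)) :
    -- the averaging operator maps `H̃ˢ(ω × B)` to `H̃ˢ(ω)`
    (∀ v ∈ HTilde s (prodCylinder ω B), avg B v ∈ HTilde s ω) ∧
    -- liminf inequality
    (∀ u ∈ HTilde s ω, ∀ v : ℕ → ProdSpace n k → ℝ, (∀ j, v j ∈ HTilde s (prodCylinder ω B)) →
      WeakTendsto s ω (fun j => avg B (v j)) u →
      (limitEnergy s ω f_inf u : EReal) ≤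
        liminf (fun j => (rescaledEnergy s ω B (ℓ j) (f (ℓ j)) (v j) : EReal)) atTop) ∧
    -- recovery sequences of the form `u(x) φ_ℓ(t)` with `φ_ℓ ∈ C_c^∞(B)`, and limsup inequality
    (∃ φ : ℕ → EuclideanSpace ℝ (Fin k) → ℝ,
      (∀ j, ContDiff ℝ (⊤ : ℕ∞) (φ j) ∧ HasCompactSupport (φ j) ∧ tsupport (φ j) ⊆ B) ∧
      ∀ u ∈ HTilde s ω, ∃ v : ℕ → ProdSpace n k → ℝ,
        (∀ j, v j = fun z => u z.fst * φ j z.snd) ∧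
        (∀ j, v j ∈ HTilde s (prodCylinder ω B)) ∧
        WeakTendsto s ω (fun j => avg B (v j)) u ∧
        limsup (fun j => (rescaledEnergy s ω B (ℓ j) (f (ℓ j)) (v j) : EReal)) atTop
          ≤ (limitEnergy s ω f_inf u : EReal)) := by
  have hlim' : Tendsto (fun j => loadError ω B (ℓ j) (f (ℓ j)) f_inf) atTop (𝓝 0) :=
    (ENNReal.tendsto_toReal ENNReal.zero_ne_top).comp hlim
  have hB0' : volume B ≠ 0 := (hB.measure_pos volume ⟨0, hB0⟩).ne'
  refine ⟨fun v hv => avg_mem_HTilde hs0.le hωb hBb hv, fun u _ v hv hw =>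
    le_liminf_rescaledEnergy hn hs0 hω hωb hB hBb hℓ hf hf_inf hlim' hv hw, ?_⟩
  obtain ⟨φ, hφ, hφ1, hφe⟩ := exists_cutoff_sequence hs0 hB
    (hBb.measure_lt_top (μ := volume)).ne hB0' hℓ hℓlim
  refine ⟨φ, fun j => ⟨(hφ j).1, (hφ j).2.1, (hφ j).2.2.1⟩, fun u hu =>
    ⟨fun j z => u z.fst * φ j z.snd, fun j => rfl, fun j => ?_, ?_, ?_⟩⟩
  · exact tensor_mem_HTilde hs0.le hs1.le hωb hu (hφ j).1 (hφ j).2.1 (hφ j).2.2.1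
  · simp_rw [avg_tensor]
    exact weakTendsto_const_smul hu hφ1
  · exact limsup_rescaledEnergy_le hs0 hs1 hω hωb hB hBb hB0' hℓ hf hf_inf hlim' hφ hφ1 hφe hu
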